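/- **Model.** A dynamic (1-interval connected) ring has $n$ anonymous nodes $v_0,\dots,v_{n-1}$ (indices mod $n$), links $e_i=\{v_i,v_{i+1}\}$, and a whiteboard at each node; in each synchronous round an adversary may remove at most one link. There are $k\le n$ agents with distinct, linearly ordered IDs from a finite set, starting at distinct nodes chosen by the adversary. Agents agree on the forward direction ($v_i\to v_{i+1}$), know $n$, $k$ and $g$, and each is a deterministic finite automaton, depending on its ID. In each round every agent performs, in an arbitrary order, one atomic action: depending on its state and on the whiteboard of its current node it changes both, and then stays, or tries to move one node forward or backward; it stays where it is if the link is missing. An agent terminates when it enters its final state, in which it never acts again. An algorithm solves the *$g$-partial gathering problem* if in every execution all agents terminate and then every node that holds an agent holds at least $g$ agents. **Theorem.** There is an absolute constant $C$ such that for all integers $g\ge 1$, $k$ and $n$ with $3g-1\le k\le 8g-4$ and $k\le n$, the following algorithm solves the $g$-partial gathering problem for $k$ agents in dynamic rings with $n$ nodes, in every execution all agents terminate within $Cn$ rounds, and the total number of agent moves is at most $C\,kn$, and also at most $C\,gn$. That is, it takes $O(n)$ rounds and $O(kn)=O(gn)$ moves. **The algorithm.** It proceeds in iterations of two rounds each: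 in the first round all agents that have not terminated register on the whiteboard of their node, which also tells them whether their last attempt to move was successful; in the second they decide, using the registrations, and try to move. Agents that have terminated at a node are counted among the agents at the node. The rank of an agent is the position of its ID among the IDs of the agents at its node. *Selection phase.* Every agent writes its ID at its initial node, and then tries to move forward in $3n$ iterations, counting its moves and recording the IDs written on the nodes it reaches (at most $k$ IDs altogether, its own included). After that, an agent terminates if it made fewer than $n$ moves, or if the number of agents at its node equals the number of IDs it recorded. Otherwise its gathering node is the node where the minimum of its recorded IDs is written. *Gathering phase.* For $3n$ iterations every agent tries to move forward until it is at the gathering node. Then agents at a node with at least $g$ and fewer than $2g$ agents terminate, and agents at a node with fewer than $g$ agents become waiting. At a node with $k'\ge 2g$ agents, those of rank at most $g$ form a forward group; the others form a backward group if $k'<3g$, while if $k'\ge 3g$ those of rank $g+1,\dots,2g$ form it and the rest terminate. During the next $n$ iterations the members of a group try to move in the direction of the group and mark each node where they are, initial node included, with this direction. After these $n$ iterations they terminate. A member of a group that reaches a node that now carries the marks of both directions terminates. Waiting agents at a node with both marks terminate. When otherwise a group reaches a node of waiting agents, these join the group; if then at least $2g$ agents are at the node, only those of rank at most $g$ go on,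 and the others terminate. -/

import Mathlib

namespace DynamicRing

/-! ### Agents in a 1-interval connected ring

Nodes are the elements `v` of `ZMod n`, and the link `e_v` joins `v` and `v + 1`. In every round at
most one link is missing. Movements are `SignType`s: `1` is forward (from `v` to `v + 1`), `-1` is
backward (from `v` to `v - 1`), `0` is staying. -/

/-- A distributed algorithm for agents with identifiers in `ID`: to each identifier it assigns a
deterministic finite automaton that reads and writes the whiteboard of the current node. All
automata share the whiteboard alphabet, and their state sets are put into one finite set. -/
structure Algorithm (ID : Type) where
  /-- States of the agents. -/
  State : Type
  /-- Contents of a whiteboard. -/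
  Board : Type
  finite_state : Finite State
  finite_board : Finite Board
  /-- From the agent's state and the current whiteboard: new state, new whiteboard, movement. -/
  trans : ID → State → Board → State × Board × SignType
  initial : ID → State
  final : ID → State
  /-- Initial whiteboard of a node that holds an agent. -/
  occupiedBoard : Board
  /-- Initial whiteboard of a node that holds no agent. -/
  emptyBoard : Board
  trans_final : ∀ i w, trans i (final i) w = (final i, w, 0)

/-- Everything that is beyond the control of an algorithm: the distinct identifiers and the distinct
initial nodes of the `k` agents, the missing link of every round (`none` if no link is missing), and
the order in which the agents perform their atomic actions in every round. -/
structure Scenario (ID : Type) (n k : ℕ) where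
  ident : Fin k ↪ ID
  home : Fin k ↪ ZMod n
  missing : ℕ → Option (ZMod n)
  order : ℕ → Equiv.Perm (Fin k)

/-- States of all agents, contents of all whiteboards, locations of all agents. -/
structure Config {ID : Type} (A : Algorithm ID) (n k : ℕ) where
  state : Fin k → A.State
  board : ZMod n → A.Board
  loc : Fin k → ZMod n

/-- The node reached from `v` by the movement `m` when the link `e` is missing. An agent that tries
to cross the missing link is blocked, and stays at `v`. -/
def hop {n : ℕ} (e : Option (ZMod n)) (v : ZMod n) (m : SignType) : ZMod n :=
  match m with
  | .zero => v
  | .pos => if e = some v then v else v + 1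
  | .neg => if e = some (v - 1) then v else v - 1

section Execution

variable {ID : Type} (A : Algorithm ID) {n k : ℕ} (sc : Scenario ID n k)

open Classical in
/-- The initial configuration. -/
noncomputable def initConfig : Config A n k where
  state a := A.initial (sc.ident a)
  board v := if ∃ a, sc.home a = v then A.occupiedBoard else A.emptyBoard
  loc := sc.home

variable {A}

/-- One atomic action of the agent `a`, when the link `e` is missing. -/
def atomicAction (e : Option (ZMod n)) (c : Config A n k) (a : Fin k) : Config A n k :=
  let r := A.trans (sc.ident a) (c.state a) (c.board (c.loc a))
  { state := Function.update c.state a r.1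
    board := Function.update c.board (c.loc a) r.2.1
    loc := Function.update c.loc a (hop e (c.loc a) r.2.2) }

/-- The round number `t`: every agent performs one atomic action, in the order of that round. -/
def round (t : ℕ) (c : Config A n k) : Config A n k :=
  ((List.finRange k).map (sc.order t)).foldl (atomicAction sc (sc.missing t)) c

variable (A)

/-- The execution: the configuration after `t` rounds. -/
noncomputable def exec : ℕ → Config A n k
  | 0 => initConfig A sc
  | t + 1 => round sc t (exec t)

variable {A}

/-- A final configuration: all agents have terminated. -/
def IsFinal (c : Config A n k) : Prop := ∀ a, c.state a = A.final (sc.ident a)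

/-- The number of agents at the node `v`. -/
def agentsAt (c : Config A n k) (v : ZMod n) : ℕ :=
  (Finset.univ.filter fun a => c.loc a = v).card

variable (A)

/-- The total number of agent moves in the first `t` rounds (blocked attempts are no moves). -/
noncomputable def movesUpTo (t : ℕ) : ℕ :=
  ∑ r ∈ Finset.range t,
    (Finset.univ.filter fun a => (exec A sc (r + 1)).loc a ≠ (exec A sc r).loc a).card

end Execution

/-- The algorithm solves the `g`-partial gathering problem for `k` agents in dynamic rings with `n`
nodes: every execution reaches a final configuration, and there at least `g` agents are at every
node where an agent is. (A final configuration never changes.) -/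
def Algorithm.SolvesPartialGathering {ID : Type} (A : Algorithm ID) (n k g : ℕ) : Prop :=
  ∀ sc : Scenario ID n k, ∃ t, IsFinal sc (exec A sc t) ∧
    ∀ a, g ≤ agentsAt (exec A sc t) ((exec A sc t).loc a)

/-- Every execution reaches a final configuration within `T` rounds. -/
def Algorithm.TerminatesWithin {ID : Type} (A : Algorithm ID) (n k T : ℕ) : Prop :=
  ∀ sc : Scenario ID n k, ∃ t ≤ T, IsFinal sc (exec A sc t)

/-- In every execution the total number of agent moves is at most `M`. -/
def Algorithm.MovesAtMost {ID : Type} (A : Algorithm ID) (n k M : ℕ) : Prop :=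
  ∀ (sc : Scenario ID n k) (t : ℕ), movesUpTo A sc t ≤ M

/-! ### The proposed algorithm

Each iteration of a loop of the algorithm takes two rounds. In the first one, every agent that has
not terminated signs the whiteboard of its current node (`signIn`), and in the second one all agents
decide on the basis of these signatures and try to move (`act`). So agents that are at the same
node decide on the basis of the same information, in whatever order they act. -/

namespace SmallK

/-- Variables of an agent that has not terminated. -/
structure Memory (ID : Type) (n : ℕ) where
  /-- Number of the current iteration, counted from 1 over the whole execution:
  `3n` iterations of the selection phase, `3n` iterations of moving to the gathering node, and
  `n` iterations of moving in groups. -/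
  rounds : Fin (7 * n + 2)
  /-- Whether the agent has signed in this iteration. -/
  signed : Bool
  /-- Whether the last attempt to move was successful. -/
  reached : Bool
  /-- Number of nodes visited in the selection phase. -/
  nVisited : Fin (3 * n + 1)
  /-- The IDs observed in the selection phase; their number is `nIDs`. -/
  ids : Finset ID
  /-- Direction of the group the agent belongs to, `0` if there is no such group. -/
  dir : SignType

/-- Variables of a node. -/
structure Board (ID : Type) (n : ℕ) where
  /-- The ID of the agent that started here. -/
  id : Option ID
  /-- The last iteration in which an agent signed here (`0` if never). -/
  stamp : ID → Fin (7 * n + 2)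
  /-- The agents that terminated here. -/
  done : Finset ID
  /-- Direction of the first group that arrived here, `0` if there is no such group. -/
  dir : SignType
  /-- Whether fewer than `g` agents stay here waiting for a group. -/
  waiting : Bool
  /-- Whether a forward group visited the node. -/
  fMarked : Bool
  /-- Whether a backward group visited the node. -/
  bMarked : Bool

theorem finite_memory (ID : Type) [Finite ID] (n : ℕ) : Finite (Memory ID n) :=
  Finite.of_injective
    (fun m : Memory ID n => (m.rounds, m.signed, m.reached, m.nVisited, m.ids, m.dir)) (by
      rintro ⟨⟩ ⟨⟩ h
      simp_all)

theorem finite_board (ID : Type) [Finite ID] (n : ℕ) : Finite (Board ID n) :=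
  Finite.of_injective
    (fun w : Board ID n => (w.id, w.stamp, w.done, w.dir, w.waiting, w.fMarked, w.bMarked)) (by
      rintro ⟨⟩ ⟨⟩ h
      simp_all)

/-- Increment a bounded counter. -/
def bump {m : ℕ} (x : Fin (m + 1)) : Fin (m + 1) := ⟨min (x + 1) m, by omega⟩

section Behavior

variable {ID : Type} [LinearOrder ID] {n : ℕ}

/-- `v.fMarked := true` or `v.bMarked := true`, according to the direction of a group. -/
def Board.mark (w : Board ID n) (d : SignType) : Board ID n :=
  { w with fMarked := w.fMarked || d == 1, bMarked := w.bMarked || d == -1 }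

/-- Actions return `none` for the final state. -/
abbrev Result (ID : Type) (n : ℕ) : Type := Option (Memory ID n) × Board ID n × SignType

/-- Terminate at the current node. -/
def terminate (x : ID) (w : Board ID n) : Result ID n :=
  (none, { w with done := insert x w.done }, 0)

/-- End the current iteration by the movement `m`. -/
def next (a : Memory ID n) (w : Board ID n) (m : SignType) : Result ID n :=
  (some { a with rounds := bump a.rounds, signed := false }, w, m)

/-- First round of an iteration of the agent with ID `x`. The agent was here in the preceding
iteration, which means that it did not reach another node, if and only if its last signature here is
from that iteration. In the selection phase it then records the ID written on a new node, and at
most `k` IDs altogether; as a member of a group it marks a new node. -/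
def signIn (k : ℕ) (x : ID) (a : Memory ID n) (w : Board ID n) : Result ID n :=
  let r : ℕ := a.rounds
  let reached : Bool := decide ((w.stamp x : ℕ) + 1 ≠ r)
  let a' : Memory ID n := { a with signed := true, reached := reached }
  let w' : Board ID n := { w with stamp := Function.update w.stamp x a.rounds }
  if r = 1 then
    (some { a' with ids := {x} }, { w' with id := some x }, 0)
  else if reached && decide (r ≤ 3 * n + 1) then
    (some { a' with
        nVisited := bump a.nVisited
        ids := if a.ids.card < k then a.ids ∪ w.id.toFinset else a.ids }, w', 0)
  else if reached && decide (6 * n + 1 < r) then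
    (some a', { w'.mark a.dir with dir := if w.dir = 0 then a.dir else w.dir }, 0)
  else
    (some a', w', 0)

/-- Whether the current node is the gathering node, where the minimum of the observed IDs is
written. -/
def atGatheringNode (a : Memory ID n) (w : Board ID n) : Prop :=
  ∃ y ∈ a.ids, w.id = some y ∧ ∀ z ∈ a.ids, y ≤ z

instance (a : Memory ID n) (w : Board ID n) : Decidable (atGatheringNode a w) := by
  unfold atGatheringNode
  infer_instance

/-- Iteration of the first part of the gathering phase: move forward up to the gathering node. -/
def gatherStep (a : Memory ID n) (w : Board ID n) : Result ID n :=
  next a w (if atGatheringNode a w then 0 else 1)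

/-- Iteration of moving in a group; it comes to an end after `n` iterations. -/
def groupStep (x : ID) (a : Memory ID n) (w : Board ID n) : Result ID n :=
  if (a.rounds : ℕ) ≤ 7 * n then next a (w.mark a.dir) a.dir else terminate x w

variable [Fintype ID]

/-- The IDs of the agents at the node, in iteration `r`. -/
def present (w : Board ID n) (r : Fin (7 * n + 2)) : Finset ID :=
  Finset.univ.filter fun y => w.stamp y = r ∨ y ∈ w.done

/-- The number of agents at the current node. -/
def nAgents (a : Memory ID n) (w : Board ID n) : ℕ := (present w a.rounds).card

/-- The ordinal number (from 1) of the ID `x` among the IDs of the agents at the current node. -/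
def rank (x : ID) (a : Memory ID n) (w : Board ID n) : ℕ :=
  ((present w a.rounds).filter fun y => y ≤ x).card

/-- Choice of a group at a node with at least `2g` agents. -/
def more (g : ℕ) (x : ID) (a : Memory ID n) (w : Board ID n) : Result ID n :=
  if rank x a w ≤ g then groupStep x { a with dir := 1 } w
  else if nAgents a w < 3 * g ∨ rank x a w ≤ 2 * g then groupStep x { a with dir := -1 } w
  else terminate x w

/-- Iteration of an agent that waits for a group at a node with fewer than `g` agents. If a group
has arrived, the agent joins it, and all but `g` agents terminate if the group is too large. -/
def lessStep (g : ℕ) (x : ID) (a : Memory ID n) (w : Board ID n) : Result ID n :=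
  if w.fMarked && w.bMarked then terminate x w
  else if w.fMarked || w.bMarked then
    if 2 * g ≤ nAgents a w ∧ g + 1 ≤ rank x a w then terminate x w
    else groupStep x { a with dir := w.dir } w
  else next a w 0

/-- Iteration of a member of a group: it terminates if it reached a node that a group of the other
direction has visited, or if it reached a node of waiting agents and the joint group is too large
for it to go on. -/
def movingStep (g : ℕ) (x : ID) (a : Memory ID n) (w : Board ID n) : Result ID n :=
  if a.reached && w.fMarked && w.bMarked then terminate x w
  else if a.reached && w.waiting && decide (2 * g ≤ nAgents a w ∧ g + 1 ≤ rank x a w) then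
    terminate x w
  else groupStep x a w

/-- Second round of an iteration of the agent with ID `x`. -/
def act (g : ℕ) (x : ID) (a : Memory ID n) (w : Board ID n) : Result ID n :=
  let r : ℕ := a.rounds
  if r ≤ 3 * n then next a w 1
  else if r = 3 * n + 1 then
    if (a.nVisited : ℕ) < n then terminate x w
    else if nAgents a w = a.ids.card then terminate x w
    else gatherStep a w
  else if r ≤ 6 * n then gatherStep a w
  else if r = 6 * n + 1 then
    if nAgents a w < g then next a { w with waiting := true } 0
    else if nAgents a w < 2 * g then terminate x w
    else more g x a w
  else if a.dir = 0 then lessStep g x a w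
  else movingStep g x a w

end Behavior

/-- The proposed algorithm for `3g - 1 ≤ k ≤ 8g - 4`, where the agents know `n`, `k` and `g`. -/
def algorithm (ID : Type) [LinearOrder ID] [Fintype ID] (n k g : ℕ) : Algorithm ID where
  State := Option (Memory ID n)
  Board := Board ID n
  finite_state := by
    have := finite_memory ID n
    infer_instance
  finite_board := finite_board ID n
  trans x s w :=
    match s with
    | none => (none, w, 0)
    | some a => if a.signed then act g x a w else signIn k x a w
  initial _ := some
    { rounds := 1, signed := false, reached := false, nVisited := 0, ids := ∅, dir := 0 }
  final _ := none
  occupiedBoard := { id := none, stamp := fun _ => 0, done := ∅, dir := 0, waiting := false,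
                     fMarked := false, bMarked := false }
  emptyBoard := { id := none, stamp := fun _ => 0, done := ∅, dir := 0, waiting := false,
                  fMarked := false, bMarked := false }
  trans_final _ _ := rfl

end SmallK

end DynamicRing

/-!
All agents go through the iterations of the algorithm at the same time, and the signatures on a
whiteboard tell which agents are at the node. What an agent reads in the second round of an
iteration is not changed by the other agents that act at this node before it (`act_congr`,
`SignedInv.actSpec`), so the order of the actions does not matter, and agents at the same node that
differ only by their IDs take the same decisions as long as ranks are not involved.

*Selection phase.* Two agents that try to move forward never overtake each other, and they stay
together once they have met. While they are apart, the missing link blocks at most one of them. So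
if an agent makes fewer than `n` moves in `3n` iterations, then every other agent meets it
(`ForwardWalk.eq_of_walkMoves_lt`): all agents are at one node, they notice this and terminate.
Otherwise every agent has visited all nodes and knows all IDs, and so all agents agree both on
whether they are all together and on the gathering node (`selection_end`).

*Gathering phase, first part.* By the same argument, two agents that do not reach the gathering node
in `3n` iterations have met. So afterwards the agents are at no more than two nodes (`gathering`).
If there are fewer than `g` agents at one of them, then there are at least `2g` at the other one,
since `k ≥ 3g - 1`.

*Gathering phase, second part.* Call two agents *twins* if they are at the same node and both have
terminated, or belong to groups of the same direction and made the same last step. In iteration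
`6n + 1`, all agents except the waiting ones fall into classes of at least `g` twins
(`manyTwins_first`). Twins stay twins (`Twin.succ`), except when a group arrives at waiting
agents; but then either all agents at this node terminate, or these agents are all the agents of
one joint group, which is kept or is split into `g` agents that go on and at least `g` agents that
terminate (`GroupInv.manyTwins_arrival`). If agents wait, then there is one group of each direction,
and both start at the other node. Two groups that have not met try to cross different links, so that
at least one of them moves in every iteration (`hop_ray_ne_or`). Hence a group arrives at the
waiting agents in time, and every agent terminates among at least `g` agents. The invariant of this
part is `GroupInv`.
-/

namespace DynamicRing

namespace SmallK

/-! ### Rounds of the algorithm -/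

section Rounds

variable {ID : Type} [LinearOrder ID] [Fintype ID] {n k : ℕ} (g : ℕ) (sc : Scenario ID n k)

/-- The memory of the agent `a` after `t` rounds, `none` if it has terminated. -/
noncomputable def mem (t : ℕ) (a : Fin k) : Option (Memory ID n) :=
  (exec (algorithm ID n k g) sc t).state a

/-- The whiteboard of the node `v` after `t` rounds. -/
noncomputable def brd (t : ℕ) (v : ZMod n) : Board ID n :=
  (exec (algorithm ID n k g) sc t).board v

/-- The node of the agent `a` after `t` rounds. -/
noncomputable def pos (t : ℕ) (a : Fin k) : ZMod n :=
  (exec (algorithm ID n k g) sc t).loc a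

/-- The transition function of the algorithm. -/
def trans (k g : ℕ) (x : ID) (s : Option (Memory ID n)) (w : Board ID n) : Result ID n :=
  (algorithm ID n k g).trans x s w

@[simp] theorem trans_none (x : ID) (w : Board ID n) :
    trans k g x none w = (none, w, 0) := rfl

theorem trans_some (x : ID) (m : Memory ID n) (w : Board ID n) :
    trans k g x (some m) w = if m.signed then act g x m w else signIn k x m w := rfl

end Rounds

section Spec

variable {ID : Type} {n k : ℕ} {A : Algorithm ID} {sc : Scenario ID n k}

/-- The effect of a sequence of atomic actions of different agents, when there is a condition `Inv`
on the whiteboards that is stable under these actions and under which every action changes state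
and location of the agent in a way that does not depend on the order. The condition may depend on
the set of the agents that have acted. -/
theorem foldl_spec {e : Option (ZMod n)} {c₀ : Config A n k}
    {Inv : ZMod n → Finset (Fin k) → A.Board → Prop}
    {s' : Fin k → A.State} {mv : Fin k → SignType}
    (hstep : ∀ a P w, a ∉ P → Inv (c₀.loc a) P w →
      (A.trans (sc.ident a) (c₀.state a) w).1 = s' a ∧
      (A.trans (sc.ident a) (c₀.state a) w).2.2 = mv a ∧
      Inv (c₀.loc a) (insert a P) (A.trans (sc.ident a) (c₀.state a) w).2.1)
    (hother : ∀ v a P w, a ∉ P → c₀.loc a ≠ v → Inv v P w → Inv v (insert a P) w)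
    (l : List (Fin k)) (P : Finset (Fin k)) (c : Config A n k)
    (hl : l.Nodup) (hP : ∀ a ∈ l, a ∉ P)
    (h1 : ∀ a, c.state a = if a ∈ P then s' a else c₀.state a)
    (h2 : ∀ a, c.loc a = if a ∈ P then hop e (c₀.loc a) (mv a) else c₀.loc a)
    (h3 : ∀ v, Inv v P (c.board v)) :
    (∀ a, (l.foldl (atomicAction sc e) c).state a =
      if a ∈ P ∪ l.toFinset then s' a else c₀.state a) ∧
    (∀ a, (l.foldl (atomicAction sc e) c).loc a =
      if a ∈ P ∪ l.toFinset then hop e (c₀.loc a) (mv a) else c₀.loc a) ∧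
    ∀ v, Inv v (P ∪ l.toFinset) ((l.foldl (atomicAction sc e) c).board v) := by
  induction l generalizing P c with
  | nil => simpa using ⟨h1, h2, h3⟩
  | cons b l ih =>
    have hb : b ∉ P := hP b (by simp)
    have hst : c.state b = c₀.state b := by rw [h1, if_neg hb]
    have hlo : c.loc b = c₀.loc b := by rw [h2, if_neg hb]
    obtain ⟨k1, k2, k3⟩ := hstep b P (c.board (c₀.loc b)) hb (h3 _)
    have hU : P ∪ (b :: l).toFinset = insert b P ∪ l.toFinset := by
      ext; simp
    rw [hU, List.foldl_cons]
    rw [List.nodup_cons] at hl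
    apply ih
    · exact hl.2
    · intro a ha
      have : a ≠ b := fun h => hl.1 (h ▸ ha)
      simp [this, hP a (by simp [ha])]
    · intro a
      by_cases hab : a = b
      · subst hab
        simp only [atomicAction, Function.update_self, Finset.mem_insert_self, if_true]
        rw [hlo, hst]
        exact k1
      · simp [atomicAction, hab, h1 a]
    · intro a
      by_cases hab : a = b
      · subst hab
        simp only [atomicAction, Function.update_self, Finset.mem_insert_self, if_true]
        rw [hlo, hst]
        exact congrArg _ k2
      · simp [atomicAction, hab, h2 a]
    · intro v
      by_cases hv : v = c₀.loc b
      · subst hv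
        simp only [atomicAction, hlo, Function.update_self, hst]
        exact k3
      · have h : (atomicAction sc e c b).board v = c.board v := by
          simp [atomicAction, hlo, hv]
        rw [h]
        exact hother v b P _ hb (Ne.symm hv) (h3 v)

/-- The effect of a round; see `foldl_spec`. -/
theorem exec_succ_spec {t : ℕ} {Inv : ZMod n → Finset (Fin k) → A.Board → Prop}
    {s' : Fin k → A.State} {mv : Fin k → SignType}
    (h0 : ∀ v, Inv v ∅ ((exec A sc t).board v))
    (hstep : ∀ a P w, a ∉ P → Inv ((exec A sc t).loc a) P w →
      (A.trans (sc.ident a) ((exec A sc t).state a) w).1 = s' a ∧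
      (A.trans (sc.ident a) ((exec A sc t).state a) w).2.2 = mv a ∧
      Inv ((exec A sc t).loc a) (insert a P)
        (A.trans (sc.ident a) ((exec A sc t).state a) w).2.1)
    (hother : ∀ v a P w, a ∉ P → (exec A sc t).loc a ≠ v → Inv v P w → Inv v (insert a P) w) :
    (∀ a, (exec A sc (t + 1)).state a = s' a) ∧
    (∀ a, (exec A sc (t + 1)).loc a = hop (sc.missing t) ((exec A sc t).loc a) (mv a)) ∧
    ∀ v, Inv v Finset.univ ((exec A sc (t + 1)).board v) := by
  have key := foldl_spec (e := sc.missing t) hstep hother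
    ((List.finRange k).map (sc.order t)) ∅ (exec A sc t)
    ((List.nodup_finRange k).map (sc.order t).injective) (by simp) (by simp) (by simp) h0
  have hU : ∅ ∪ ((List.finRange k).map (sc.order t)).toFinset = Finset.univ := by
    ext a
    simpa using ⟨(sc.order t).symm a, by simp⟩
  rw [hU] at key
  simp only [Finset.mem_univ, if_true] at key
  exact key

theorem final_foldl {e : Option (ZMod n)} {a : Fin k} (l : List (Fin k)) (c : Config A n k)
    (h : c.state a = A.final (sc.ident a)) :
    (l.foldl (atomicAction sc e) c).state a = A.final (sc.ident a) ∧
      (l.foldl (atomicAction sc e) c).loc a = c.loc a := by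
  induction l generalizing c with
  | nil => exact ⟨h, rfl⟩
  | cons b l ih =>
    rw [List.foldl_cons]
    have h1 : (atomicAction sc e c b).state a = A.final (sc.ident a) ∧
        (atomicAction sc e c b).loc a = c.loc a := by
      by_cases hab : a = b
      · subst hab
        simp [atomicAction, h, A.trans_final, hop]
      · simpa [atomicAction, hab] using h
    exact ⟨(ih _ h1.1).1, (ih _ h1.1).2.trans h1.2⟩

end Spec

section Rounds

variable {ID : Type} [LinearOrder ID] [Fintype ID] {n k g : ℕ} {sc : Scenario ID n k}

/-- The effect of a round; see `foldl_spec`. -/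
theorem round_spec {t : ℕ} {Inv : ZMod n → Finset (Fin k) → Board ID n → Prop}
    {s' : Fin k → Option (Memory ID n)} {mv : Fin k → SignType}
    (h0 : ∀ v, Inv v ∅ (brd g sc t v))
    (hstep : ∀ a P w, a ∉ P → Inv (pos g sc t a) P w →
      (trans k g (sc.ident a) (mem g sc t a) w).1 = s' a ∧
      (trans k g (sc.ident a) (mem g sc t a) w).2.2 = mv a ∧
      Inv (pos g sc t a) (insert a P) (trans k g (sc.ident a) (mem g sc t a) w).2.1)
    (hother : ∀ v a P w, a ∉ P → pos g sc t a ≠ v → Inv v P w → Inv v (insert a P) w) :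
    (∀ a, mem g sc (t + 1) a = s' a) ∧
    (∀ a, pos g sc (t + 1) a = hop (sc.missing t) (pos g sc t a) (mv a)) ∧
    ∀ v, Inv v Finset.univ (brd g sc (t + 1) v) :=
  exec_succ_spec (A := algorithm ID n k g) h0 hstep hother

theorem dead_succ {t : ℕ} {a : Fin k} (h : mem g sc t a = none) :
    mem g sc (t + 1) a = none ∧ pos g sc (t + 1) a = pos g sc t a :=
  final_foldl (A := algorithm ID n k g) _ _ h

theorem dead_mono {t t' : ℕ} {a : Fin k} (h : mem g sc t a = none) (ht : t ≤ t') :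
    mem g sc t' a = none ∧ pos g sc t' a = pos g sc t a := by
  induction t', ht using Nat.le_induction with
  | base => exact ⟨h, rfl⟩
  | succ t' _ ih => exact ⟨(dead_succ ih.1).1, (dead_succ ih.1).2.trans ih.2⟩

/-- If all agents have terminated after `T` rounds, then they made at most `k * T` moves. -/
theorem movesUpTo_le {T : ℕ} (hT : ∀ a, mem g sc T a = none) (t : ℕ) :
    movesUpTo (algorithm ID n k g) sc t ≤ k * T := by
  have h1 : ∀ r ∈ Finset.range t,
      (Finset.univ.filter fun a => (exec (algorithm ID n k g) sc (r + 1)).loc a ≠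
        (exec (algorithm ID n k g) sc r).loc a).card ≤ if r < T then k else 0 := by
    intro r _
    split_ifs with hr
    · exact (Finset.card_le_univ _).trans (by simp)
    · rw [Nat.le_zero, Finset.card_eq_zero, Finset.filter_eq_empty_iff]
      intro a _
      rw [not_not]
      exact (dead_succ (dead_mono (hT a) (not_lt.1 hr)).1).2
  refine (Finset.sum_le_sum h1).trans ?_
  rw [← Finset.sum_filter, Finset.sum_const, smul_eq_mul, mul_comm]
  refine Nat.mul_le_mul_left _ ?_
  calc _ ≤ (Finset.range T).card := Finset.card_le_card (fun r => by simp)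
    _ = T := Finset.card_range T

end Rounds

/-- In a finite linear order, there are `j` elements of rank at most `j`. -/
theorem card_filter_rank_le {α : Type*} [LinearOrder α] (S : Finset α) (j : ℕ) :
    (S.filter fun x => (S.filter (· ≤ x)).card ≤ j).card = min j S.card := by
  induction S using Finset.induction_on_max with
  | empty => simp
  | insert m S hm ih =>
    have hmS : m ∉ S := fun h => lt_irrefl _ (hm m h)
    have h1 : (insert m S).filter (· ≤ m) = insert m S := by
      rw [Finset.filter_eq_self]
      intro x hx
      rcases Finset.mem_insert.1 hx with rfl | h
      · exact le_rfl
      · exact (hm x h).le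
    have h2 : ∀ x ∈ S, (insert m S).filter (· ≤ x) = S.filter (· ≤ x) := by
      intro x hx
      rw [Finset.filter_insert, if_neg (not_le.2 (hm x hx))]
    have h3 : (S.filter fun x => ((insert m S).filter (· ≤ x)).card ≤ j) =
        S.filter fun x => (S.filter (· ≤ x)).card ≤ j :=
      Finset.filter_congr fun x hx => by rw [h2 x hx]
    rw [Finset.filter_insert, h1, h3, Finset.card_insert_of_notMem hmS]
    split_ifs with h
    · rw [Finset.card_insert_of_notMem (by simp [hmS]), ih]
      omega
    · rw [ih]
      omega

/-! ### Single actions -/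

section Actions

variable {ID : Type} {n : ℕ}

/-- The node carries the mark of direction `d`. -/
def Board.Marked (w : Board ID n) (d : SignType) : Prop :=
  d = 1 ∧ w.fMarked = true ∨ d = -1 ∧ w.bMarked = true

theorem Board.marked_one {w : Board ID n} : w.Marked 1 ↔ w.fMarked = true := by
  simp [Board.Marked]

theorem Board.marked_neg_one {w : Board ID n} : w.Marked (-1) ↔ w.bMarked = true := by
  simp [Board.Marked]

theorem Board.Marked.ne_zero {w : Board ID n} {d : SignType} (h : w.Marked d) : d ≠ 0 := by
  rcases h with ⟨rfl, _⟩ | ⟨rfl, _⟩ <;> decide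

theorem Board.marked_mark {w : Board ID n} {d e : SignType} :
    (w.mark e).Marked d ↔ w.Marked d ∨ d = e ∧ d ≠ 0 := by
  unfold Board.Marked Board.mark
  rcases SignType.trichotomy d with rfl | rfl | rfl <;>
  rcases SignType.trichotomy e with rfl | rfl | rfl <;> simp

variable [LinearOrder ID] [Fintype ID] {k g : ℕ} {x : ID} {m : Memory ID n} {w w₀ : Board ID n}

/-- What an agent in its second round of an iteration reads from the whiteboard: marks, waiting
agents and the direction of the first group only matter after iteration `6n + 1`. -/
structure SameView (r : Fin (7 * n + 2)) (w w₀ : Board ID n) : Prop where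
  id : w.id = w₀.id
  present : present w r = present w₀ r
  fMarked : 6 * n + 1 < (r : ℕ) → w.fMarked = w₀.fMarked
  bMarked : 6 * n + 1 < (r : ℕ) → w.bMarked = w₀.bMarked
  waiting : 6 * n + 1 < (r : ℕ) → w.waiting = w₀.waiting
  dir : 6 * n + 1 < (r : ℕ) → w.dir = w₀.dir

omit [Fintype ID] in
theorem gatherStep_congr (h : w.id = w₀.id) :
    (gatherStep m w).1 = (gatherStep m w₀).1 ∧
      (gatherStep m w).2.2 = (gatherStep m w₀).2.2 := by
  have : atGatheringNode m w ↔ atGatheringNode m w₀ := by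
    unfold atGatheringNode
    rw [h]
  simp [gatherStep, next, this]

omit [Fintype ID] in
theorem groupStep_congr : (groupStep x m w).1 = (groupStep x m w₀).1 ∧
      (groupStep x m w).2.2 = (groupStep x m w₀).2.2 := by
  unfold groupStep
  split_ifs <;> simp [next, terminate]

theorem act_congr (h : SameView m.rounds w w₀) :
    (act g x m w).1 = (act g x m w₀).1 ∧ (act g x m w).2.2 = (act g x m w₀).2.2 := by
  have hn : nAgents m w = nAgents m w₀ := by rw [nAgents, nAgents, h.present]
  have hr : ∀ y, rank y m w = rank y m w₀ := fun y => by rw [rank, rank, h.present]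
  unfold act
  dsimp only
  by_cases h1 : (m.rounds : ℕ) ≤ 3 * n
  · simp [h1, next]
  by_cases h2 : (m.rounds : ℕ) = 3 * n + 1
  · simp only [if_neg h1, if_pos h2, hn]
    split_ifs
    · simp [terminate]
    · simp [terminate]
    · exact gatherStep_congr h.id
  by_cases h3 : (m.rounds : ℕ) ≤ 6 * n
  · simp only [if_neg h1, if_neg h2, if_pos h3]
    exact gatherStep_congr h.id
  by_cases h4 : (m.rounds : ℕ) = 6 * n + 1
  · simp only [if_neg h1, if_neg h2, if_neg h3, if_pos h4, hn, more, hr]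
    split_ifs
    all_goals first | exact groupStep_congr | simp [next, terminate]
  · have h5 : 6 * n + 1 < (m.rounds : ℕ) := by omega
    simp only [if_neg h1, if_neg h2, if_neg h3, if_neg h4, lessStep, movingStep, hn, hr,
      h.fMarked h5, h.bMarked h5, h.waiting h5, h.dir h5]
    split_ifs
    all_goals first | exact groupStep_congr | simp [next, terminate]

/-- The possible outcomes of the second round of an iteration. -/
theorem act_cases [NeZero n] :
    (act g x m w = terminate x w ∧ ¬ ((m.rounds : ℕ) = 6 * n + 1 ∧ nAgents m w < g)) ∨
    (∃ mv, act g x m w = next m w mv ∧ (m.rounds : ℕ) ≤ 6 * n) ∨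
    (act g x m w = next m { w with waiting := true } 0 ∧
      (m.rounds : ℕ) = 6 * n + 1 ∧ nAgents m w < g) ∨
    (∃ d, act g x m w = groupStep x { m with dir := d } w ∧ 6 * n + 1 ≤ (m.rounds : ℕ) ∧
      (6 * n + 1 < (m.rounds : ℕ) → d = m.dir ∨ d = w.dir) ∧
      ¬ ((m.rounds : ℕ) = 6 * n + 1 ∧ nAgents m w < g)) ∨
    (act g x m w = next m w 0 ∧ 6 * n + 1 < (m.rounds : ℕ) ∧ m.dir = 0) := by
  by_cases h1 : (m.rounds : ℕ) ≤ 3 * n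
  · refine Or.inr (Or.inl ⟨1, ?_, by omega⟩)
    simp [act, h1]
  by_cases h2 : (m.rounds : ℕ) = 3 * n + 1
  · have h3 : (m.rounds : ℕ) ≤ 6 * n := by
      have := NeZero.pos n
      omega
    simp only [act, if_neg h1, if_pos h2]
    split_ifs
    · exact Or.inl ⟨rfl, by omega⟩
    · exact Or.inl ⟨rfl, by omega⟩
    · exact Or.inr (Or.inl ⟨if atGatheringNode m w then 0 else 1, rfl, h3⟩)
  by_cases h3 : (m.rounds : ℕ) ≤ 6 * n
  · refine Or.inr (Or.inl ⟨if atGatheringNode m w then 0 else 1, ?_, h3⟩)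
    simp only [act, if_neg h1, if_neg h2, if_pos h3]
    rfl
  by_cases h4 : (m.rounds : ℕ) = 6 * n + 1
  · simp only [act, if_neg h1, if_neg h2, if_neg h3, if_pos h4, more]
    split_ifs with h5
    · exact Or.inr (Or.inr (Or.inl ⟨rfl, h4, h5⟩))
    · exact Or.inl ⟨rfl, fun h => h5 h.2⟩
    · exact Or.inr (Or.inr (Or.inr (Or.inl ⟨_, rfl, h4.ge, by omega, fun h => h5 h.2⟩)))
    · exact Or.inr (Or.inr (Or.inr (Or.inl ⟨_, rfl, h4.ge, by omega, fun h => h5 h.2⟩)))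
    · exact Or.inl ⟨rfl, fun h => h5 h.2⟩
  · have h5 : 6 * n + 1 < (m.rounds : ℕ) := by omega
    have h6 : ¬ ((m.rounds : ℕ) = 6 * n + 1 ∧ nAgents m w < g) := fun h => h4 h.1
    simp only [act, if_neg h1, if_neg h2, if_neg h3, if_neg h4, lessStep, movingStep]
    split_ifs with h7
    · exact Or.inl ⟨rfl, h6⟩
    · exact Or.inl ⟨rfl, h6⟩
    · exact Or.inr (Or.inr (Or.inr (Or.inl ⟨_, rfl, h5.le, fun _ => Or.inr rfl, h6⟩)))
    · exact Or.inr (Or.inr (Or.inr (Or.inr ⟨rfl, h5, h7⟩)))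
    · exact Or.inl ⟨rfl, h6⟩
    · exact Or.inl ⟨rfl, h6⟩
    · exact Or.inr (Or.inr (Or.inr (Or.inl ⟨m.dir, rfl, h5.le, fun _ => Or.inl rfl, h6⟩)))

omit [Fintype ID] in
theorem groupStep_cases : ((m.rounds : ℕ) ≤ 7 * n ∧
      groupStep x m w = next m (w.mark m.dir) m.dir) ∨
    (7 * n < (m.rounds : ℕ) ∧ groupStep x m w = terminate x w) := by
  unfold groupStep
  split_ifs with h
  · exact Or.inl ⟨h, rfl⟩
  · exact Or.inr ⟨not_le.1 h, rfl⟩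

/-- The memory of an agent that goes on after an iteration. -/
theorem act_eq_some [NeZero n] {m' : Memory ID n} (h : (act g x m w).1 = some m') :
    m'.rounds = bump m.rounds ∧ m'.signed = false ∧ m'.nVisited = m.nVisited ∧ m'.ids = m.ids ∧
      ((m.rounds : ℕ) ≤ 6 * n → m'.dir = m.dir) := by
  rcases act_cases (g := g) (x := x) (m := m) (w := w) with ⟨e, _⟩ | ⟨mv, e, _⟩ | ⟨e, _⟩ |
      ⟨d, e, h1, _⟩ | ⟨e, _⟩
  · simp [e, terminate] at h
  · rw [e] at h
    cases h
    simp
  · rw [e] at h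
    cases h
    simp
  · rw [e] at h
    rcases groupStep_cases (x := x) (m := { m with dir := d }) (w := w) with ⟨_, e'⟩ | ⟨_, e'⟩
    · rw [e'] at h
      cases h
      simp only [true_and]
      omega
    · simp [e', terminate] at h
  · rw [e] at h
    cases h
    simp

/-- The whiteboard after the second round of an iteration. -/
theorem act_board [NeZero n] :
    (act g x m w).2.1.id = w.id ∧ (act g x m w).2.1.stamp = w.stamp ∧
    (act g x m w).2.1.dir = w.dir ∧
    (act g x m w).2.1.done = (if (act g x m w).1 = none then insert x w.done else w.done) ∧
    ((act g x m w).2.1.waiting = true ↔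
      w.waiting = true ∨ (m.rounds : ℕ) = 6 * n + 1 ∧ nAgents m w < g) := by
  rcases act_cases (g := g) (x := x) (m := m) (w := w) with ⟨e, h⟩ | ⟨mv, e, h⟩ | ⟨e, h⟩ |
      ⟨d, e, h1, _, h⟩ | ⟨e, h, _⟩
  · simp [e, terminate, h]
  · have : ¬ ((m.rounds : ℕ) = 6 * n + 1 ∧ nAgents m w < g) := by omega
    simp [e, next, this]
  · simp [e, next, h]
  · rw [e]
    rcases groupStep_cases (x := x) (m := { m with dir := d }) (w := w) with ⟨_, e'⟩ | ⟨_, e'⟩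
    · simp [e', next, Board.mark, h]
    · simp [e', terminate, h]
  · have : ¬ ((m.rounds : ℕ) = 6 * n + 1 ∧ nAgents m w < g) := by omega
    simp [e, next, this]

omit [Fintype ID] in
theorem groupStep_marked {d : SignType} : (groupStep x m w).2.1.Marked d ↔
    w.Marked d ∨ ∃ m', (groupStep x m w).1 = some m' ∧ m'.dir = d ∧ d ≠ 0 := by
  unfold groupStep
  split_ifs
  · simp only [next, Board.marked_mark, Option.some.injEq, exists_eq_left']
    tauto
  · simp [terminate, Board.Marked]

theorem act_marked [NeZero n] (h0 : (m.rounds : ℕ) ≤ 6 * n + 1 → m.dir = 0) {d : SignType} :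
    (act g x m w).2.1.Marked d ↔
      w.Marked d ∨ ∃ m', (act g x m w).1 = some m' ∧ m'.dir = d ∧ d ≠ 0 := by
  have hn : ∀ (m₁ : Memory ID n) (w₁ : Board ID n) (mv : SignType), m₁.dir = 0 →
      ((∀ d, w₁.Marked d ↔ w.Marked d) → ((next m₁ w₁ mv).2.1.Marked d ↔
      w.Marked d ∨ ∃ m', (next m₁ w₁ mv).1 = some m' ∧ m'.dir = d ∧ d ≠ 0)) := by
    intro m₁ w₁ mv h1 h2
    simp only [next, Option.some.injEq, exists_eq_left', h2, h1]
    constructor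
    · exact Or.inl
    · rintro (h | ⟨rfl, h⟩)
      · exact h
      · exact absurd rfl h
  have ht : (terminate x w).2.1.Marked d ↔
      w.Marked d ∨ ∃ m', (terminate x w).1 = some m' ∧ m'.dir = d ∧ d ≠ 0 := by
    simp [terminate, Board.Marked]
  rcases act_cases (g := g) (x := x) (m := m) (w := w) with ⟨e, _⟩ | ⟨mv, e, h⟩ | ⟨e, h⟩ |
      ⟨d, e, h⟩ | ⟨e, h⟩
  · rw [e]
    exact ht
  · rw [e]
    exact hn _ _ _ (h0 (by omega)) fun _ => Iff.rfl
  · rw [e]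
    exact hn _ _ _ (h0 (by omega)) fun _ => Iff.rfl
  · rw [e]
    exact groupStep_marked
  · rw [e]
    exact hn _ _ _ h.2 fun _ => Iff.rfl

theorem act_move_of_eq_none [NeZero n] (h : (act g x m w).1 = none) :
    (act g x m w).2.2 = 0 := by
  rcases act_cases (g := g) (x := x) (m := m) (w := w) with ⟨e, _⟩ | ⟨mv, e, _⟩ | ⟨e, _, _⟩ |
      ⟨d, e, _, hd, _⟩ | ⟨e, _, h2⟩ <;> rw [e] at h ⊢
  · rfl
  · simp [next] at h
  · rfl
  · rcases groupStep_cases (x := x) (m := { m with dir := d }) (w := w) with ⟨_, e'⟩ | ⟨_, e'⟩ <;>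
      rw [e'] at h ⊢
    · simp [next] at h
    · rfl
  · rfl

/-- From iteration `6n + 1` on, agents move in the direction of their group. -/
theorem act_move_eq_dir [NeZero n] {m' : Memory ID n} (hr : 6 * n + 1 ≤ (m.rounds : ℕ))
    (h0 : (m.rounds : ℕ) = 6 * n + 1 → m.dir = 0)
    (h : (act g x m w).1 = some m') : (act g x m w).2.2 = m'.dir := by
  rcases act_cases (g := g) (x := x) (m := m) (w := w) with ⟨e, _⟩ | ⟨mv, _, _⟩ | ⟨e, h1, _⟩ |
      ⟨d, e, _, hd, _⟩ | ⟨e, _, h2⟩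
  · simp [e, terminate] at h
  · omega
  · rw [e] at h ⊢
    cases h
    exact (h0 h1).symm
  · rw [e] at h ⊢
    rcases groupStep_cases (x := x) (m := { m with dir := d }) (w := w) with ⟨_, e'⟩ | ⟨_, e'⟩ <;>
      rw [e'] at h ⊢
    · cases h
      rfl
    · simp [terminate] at h
  · rw [e] at h ⊢
    cases h
    exact h2.symm

/-- After iteration `6n + 1`, agents only go on in directions that are marked at their node. -/
theorem act_dir_marked [NeZero n] {m' : Memory ID n} (hr : 6 * n + 1 < (m.rounds : ℕ))
    (hm : m.dir ≠ 0 → w.Marked m.dir) (hw : w.dir ≠ 0 → w.Marked w.dir)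
    (h : (act g x m w).1 = some m') (h0 : m'.dir ≠ 0) : w.Marked m'.dir := by
  rcases act_cases (g := g) (x := x) (m := m) (w := w) with ⟨e, _⟩ | ⟨mv, _, _⟩ | ⟨_, _, _⟩ |
      ⟨d, e, _, hd, _⟩ | ⟨e, _, h2⟩
  · simp [e, terminate] at h
  · omega
  · omega
  · rw [e] at h
    rcases groupStep_cases (x := x) (m := { m with dir := d }) (w := w) with ⟨_, e'⟩ | ⟨_, e'⟩
    · rw [e'] at h
      cases h
      rcases hd hr with rfl | rfl
      · exact hm h0
      · exact hw h0
    · simp [e', terminate] at h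
  · rw [e] at h
    cases h
    exact absurd h2 h0

end Actions

section SignIn

variable {ID : Type} [LinearOrder ID] {n : ℕ}
variable {k : ℕ} {x : ID} {m : Memory ID n} {w : Board ID n}

theorem signIn_move : (signIn k x m w).2.2 = 0 := by
  unfold signIn
  dsimp only
  split_ifs <;> rfl

/-- The memory after the first round of the first iteration. -/
theorem signIn_first (h : (m.rounds : ℕ) = 1) : (signIn k x m w).1 =
    some { m with
      signed := true, reached := decide ((w.stamp x : ℕ) + 1 ≠ m.rounds), ids := {x} } := by
  simp [signIn, h]

/-- The memory after the first round of an iteration. -/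
theorem signIn_later (h : (m.rounds : ℕ) ≠ 1) : (signIn k x m w).1 =
    some { m with
      signed := true, reached := decide ((w.stamp x : ℕ) + 1 ≠ m.rounds)
      nVisited := if (w.stamp x : ℕ) + 1 ≠ m.rounds ∧ (m.rounds : ℕ) ≤ 3 * n + 1 then
        bump m.nVisited else m.nVisited
      ids := if (w.stamp x : ℕ) + 1 ≠ m.rounds ∧ (m.rounds : ℕ) ≤ 3 * n + 1 ∧ m.ids.card < k then
        m.ids ∪ w.id.toFinset else m.ids } := by
  unfold signIn
  simp only [if_neg h]
  split_ifs <;> simp_all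

/-- The whiteboard after the first round of an iteration. -/
theorem signIn_board :
    (signIn k x m w).2.1.stamp = Function.update w.stamp x m.rounds ∧
    (signIn k x m w).2.1.done = w.done ∧ (signIn k x m w).2.1.waiting = w.waiting ∧
    (signIn k x m w).2.1.id = (if (m.rounds : ℕ) = 1 then some x else w.id) := by
  unfold signIn
  dsimp only
  split_ifs <;> simp_all [Board.mark]

theorem signIn_dir [NeZero n] : (signIn k x m w).2.1.dir =
    if 6 * n + 1 < (m.rounds : ℕ) ∧ (w.stamp x : ℕ) + 1 ≠ m.rounds ∧ w.dir = 0 then m.dir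
      else w.dir := by
  have h := NeZero.pos n
  unfold signIn
  by_cases h1 : (m.rounds : ℕ) = 1
  · simp [h1, h.ne']
  by_cases h2 : (w.stamp x : ℕ) + 1 = m.rounds
  · simp [h1, h2]
  by_cases h3 : (m.rounds : ℕ) ≤ 3 * n + 1
  · have : ¬ 6 * n + 1 < (m.rounds : ℕ) := by omega
    simp [h1, h2, h3, this]
  by_cases h4 : 6 * n + 1 < (m.rounds : ℕ)
  · simp [h1, h2, h3, h4]
  · simp [h1, h2, h3, h4]

theorem signIn_marked [NeZero n] {d : SignType} : (signIn k x m w).2.1.Marked d ↔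
    w.Marked d ∨ 6 * n + 1 < (m.rounds : ℕ) ∧ (w.stamp x : ℕ) + 1 ≠ m.rounds ∧
      m.dir = d ∧ d ≠ 0 := by
  have h := NeZero.pos n
  unfold signIn
  by_cases h1 : (m.rounds : ℕ) = 1
  · simp [h1, h.ne', Board.Marked]
  by_cases h2 : (w.stamp x : ℕ) + 1 = m.rounds
  · simp [h1, h2, Board.Marked]
  by_cases h3 : (m.rounds : ℕ) ≤ 3 * n + 1
  · have : ¬ 6 * n + 1 < (m.rounds : ℕ) := by omega
    simp [h1, h2, h3, this, Board.Marked]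
  by_cases h4 : 6 * n + 1 < (m.rounds : ℕ)
  · have h5 := Board.marked_mark (w := { w with stamp := Function.update w.stamp x m.rounds })
      (d := d) (e := m.dir)
    simp only [h1, h2, h3, h4, ne_eq, not_false_eq_true, true_and, if_false, decide_true,
      decide_false, Bool.and_true, Bool.and_false, if_true, Bool.false_eq_true]
    rw [eq_comm (a := m.dir)]
    exact h5
  · simp [h1, h2, h3, h4, Board.Marked]

end SignIn

/-! ### Iterations -/

section Iterations

variable {ID : Type} [LinearOrder ID] [Fintype ID] {n k : ℕ}

/-- The node where the agent `a` is in the iteration number `i`, counted from `0`. This iteration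
consists of the rounds `2 * i` and `2 * i + 1`; in the memories and on the whiteboards, where
iterations are counted from `1`, it has the number `i + 1`. -/
noncomputable abbrev node (g : ℕ) (sc : Scenario ID n k) (i : ℕ) (a : Fin k) : ZMod n :=
  pos g sc (2 * i) a

/-- Properties of the configuration before the iteration number `i`, counted from `0`. The last
movement of an agent led from `node g sc (i - 1) a` to `node g sc i a`; by truncated subtraction,
these nodes coincide for `i = 0`, when there was no movement yet. -/
structure StartInv (g : ℕ) (sc : Scenario ID n k) (i : ℕ) : Prop where
  rounds : ∀ a m, mem g sc (2 * i) a = some m → (m.rounds : ℕ) = i + 1 ∧ m.signed = false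
  first : i = 0 → (∀ a, node g sc i a = sc.home a) ∧ (∀ a, ∃ m, mem g sc (2 * i) a = some m) ∧
    ∀ v, (brd g sc (2 * i) v).id = none
  stamp_le : ∀ v x, ((brd g sc (2 * i) v).stamp x : ℕ) ≤ i
  stamp_iff : ∀ a m, mem g sc (2 * i) a = some m →
    (((brd g sc (2 * i) (node g sc i a)).stamp (sc.ident a) : ℕ) = i ↔
      node g sc i a = node g sc (i - 1) a)
  done : ∀ v x, x ∈ (brd g sc (2 * i) v).done ↔
    ∃ a, sc.ident a = x ∧ mem g sc (2 * i) a = none ∧ node g sc i a = v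
  id : i ≠ 0 → ∀ v x, (brd g sc (2 * i) v).id = some x ↔ ∃ a, sc.home a = v ∧ sc.ident a = x
  early_dir : i ≤ 6 * n → ∀ a m, mem g sc (2 * i) a = some m → m.dir = 0
  early : i ≤ 6 * n → ∀ v, (brd g sc (2 * i) v).waiting = false ∧
    ∀ d, ¬ (brd g sc (2 * i) v).Marked d
  stays : 6 * n < i → ∀ a m, mem g sc (2 * i) a = some m → m.dir = 0 →
    node g sc i a = node g sc (i - 1) a
  moves : 6 * n < i → ∀ a m, mem g sc (2 * i) a = some m → m.dir ≠ 0 →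
    (brd g sc (2 * i) (node g sc i a)).Marked m.dir ∨ node g sc i a ≠ node g sc (i - 1) a
  dir_marked : ∀ v, (brd g sc (2 * i) v).dir ≠ 0 →
    (brd g sc (2 * i) v).Marked (brd g sc (2 * i) v).dir
  waiting_dir : ∀ v d, (brd g sc (2 * i) v).waiting = true → (brd g sc (2 * i) v).Marked d →
    (brd g sc (2 * i) v).dir ≠ 0

/-- Properties of the configuration in the middle of the iteration number `i`, counted from `0`. -/
structure SignedInv (g : ℕ) (sc : Scenario ID n k) (i : ℕ) : Prop where
  rounds : ∀ a m, mem g sc (2 * i + 1) a = some m → (m.rounds : ℕ) = i + 1 ∧ m.signed = true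
  pos : ∀ a, pos g sc (2 * i + 1) a = node g sc i a
  stamp_le : ∀ v x, ((brd g sc (2 * i + 1) v).stamp x : ℕ) ≤ i + 1
  stamp_iff : ∀ v x, ((brd g sc (2 * i + 1) v).stamp x : ℕ) = i + 1 ↔
    ∃ a m, sc.ident a = x ∧ mem g sc (2 * i + 1) a = some m ∧ node g sc i a = v
  done : ∀ v x, x ∈ (brd g sc (2 * i + 1) v).done ↔
    ∃ a, sc.ident a = x ∧ mem g sc (2 * i + 1) a = none ∧ node g sc i a = v
  id : ∀ v x, (brd g sc (2 * i + 1) v).id = some x ↔ ∃ a, sc.home a = v ∧ sc.ident a = x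
  reached : ∀ a m, mem g sc (2 * i + 1) a = some m →
    (m.reached = true ↔ node g sc i a ≠ node g sc (i - 1) a)
  early_dir : i ≤ 6 * n → ∀ a m, mem g sc (2 * i + 1) a = some m → m.dir = 0
  early : i ≤ 6 * n → ∀ v, (brd g sc (2 * i + 1) v).waiting = false ∧
    ∀ d, ¬ (brd g sc (2 * i + 1) v).Marked d
  marked : ∀ a m, mem g sc (2 * i + 1) a = some m → m.dir ≠ 0 →
    (brd g sc (2 * i + 1) (node g sc i a)).Marked m.dir
  dir_marked : ∀ v, (brd g sc (2 * i + 1) v).dir ≠ 0 →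
    (brd g sc (2 * i + 1) v).Marked (brd g sc (2 * i + 1) v).dir
  waiting_dir : ∀ v d, (brd g sc (2 * i + 1) v).waiting = true →
    (brd g sc (2 * i + 1) v).Marked d → (brd g sc (2 * i + 1) v).dir ≠ 0

variable {g : ℕ} {sc : Scenario ID n k}

theorem startInv_zero : StartInv g sc 0 where
  rounds a m h := by
    simp only [mem, exec, initConfig, algorithm, Option.some.injEq] at h
    subst h
    simp
  first _ := by
    refine ⟨fun a => rfl, fun a => ⟨_, rfl⟩, fun v => ?_⟩
    simp only [brd, exec, initConfig, algorithm]
    split_ifs <;> rfl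
  stamp_le v x := by
    simp only [brd, exec, initConfig, algorithm]
    split_ifs <;> simp
  stamp_iff a m _ := by
    simp only [brd, exec, initConfig, algorithm]
    split_ifs <;> simp
  done v x := by
    simp only [brd, exec, initConfig, algorithm, mem]
    split_ifs <;> simp
  id h := absurd rfl h
  early_dir _ a m h := by
    simp only [mem, exec, initConfig, algorithm, Option.some.injEq] at h
    subst h
    rfl
  early _ v := by
    simp only [brd, exec, initConfig, algorithm]
    split_ifs <;> simp [Board.Marked]
  stays h := absurd h (by omega)
  moves h := absurd h (by omega)
  dir_marked v := by
    simp only [brd, exec, initConfig, algorithm]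
    split_ifs <;> simp
  waiting_dir v d := by
    simp only [brd, exec, initConfig, algorithm]
    split_ifs <;> simp

/-- The first round of an iteration. -/
structure SignSpec (g : ℕ) (sc : Scenario ID n k) (i : ℕ) : Prop where
  mem : ∀ a, mem g sc (2 * i + 1) a =
    (trans k g (sc.ident a) (mem g sc (2 * i) a) (brd g sc (2 * i) (node g sc i a))).1
  pos : ∀ a, pos g sc (2 * i + 1) a = node g sc i a
  stamp : ∀ v, (∀ a m, SmallK.mem g sc (2 * i) a = some m → node g sc i a = v →
      ((brd g sc (2 * i + 1) v).stamp (sc.ident a) : ℕ) = i + 1) ∧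
    ∀ x, (∀ a m, SmallK.mem g sc (2 * i) a = some m → node g sc i a = v → sc.ident a ≠ x) →
      (brd g sc (2 * i + 1) v).stamp x = (brd g sc (2 * i) v).stamp x
  done : ∀ v, (brd g sc (2 * i + 1) v).done = (brd g sc (2 * i) v).done
  waiting : ∀ v, (brd g sc (2 * i + 1) v).waiting = (brd g sc (2 * i) v).waiting
  id : ∀ v, (i ≠ 0 → (brd g sc (2 * i + 1) v).id = (brd g sc (2 * i) v).id) ∧
    (i = 0 → ∀ x, (brd g sc (2 * i + 1) v).id = some x ↔ ∃ a, node g sc i a = v ∧ sc.ident a = x)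
  marked : ∀ v d, (brd g sc (2 * i + 1) v).Marked d ↔ (brd g sc (2 * i) v).Marked d ∨
    6 * n < i ∧ ∃ a m, SmallK.mem g sc (2 * i) a = some m ∧ node g sc i a = v ∧
      node g sc i a ≠ node g sc (i - 1) a ∧ m.dir = d ∧ d ≠ 0
  dir_marked : ∀ v, (brd g sc (2 * i + 1) v).dir ≠ 0 →
    (brd g sc (2 * i + 1) v).Marked (brd g sc (2 * i + 1) v).dir
  waiting_dir : ∀ v d, (brd g sc (2 * i + 1) v).waiting = true →
    (brd g sc (2 * i + 1) v).Marked d → (brd g sc (2 * i + 1) v).dir ≠ 0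

theorem StartInv.signSpec [NeZero n] {i : ℕ} (h : StartInv g sc i) : SignSpec g sc i := by
  have key := round_spec (g := g) (sc := sc) (t := 2 * i)
    (Inv := fun v P w =>
      ((∀ a ∈ P, ∀ m, mem g sc (2 * i) a = some m → node g sc i a = v →
        (w.stamp (sc.ident a) : ℕ) = i + 1) ∧
      ∀ x, (∀ a ∈ P, ∀ m, mem g sc (2 * i) a = some m → node g sc i a = v → sc.ident a ≠ x) →
        w.stamp x = (brd g sc (2 * i) v).stamp x) ∧
      w.done = (brd g sc (2 * i) v).done ∧
      w.waiting = (brd g sc (2 * i) v).waiting ∧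
      ((i ≠ 0 → w.id = (brd g sc (2 * i) v).id) ∧
        (i = 0 → ∀ x, w.id = some x ↔ ∃ a ∈ P, node g sc i a = v ∧ sc.ident a = x)) ∧
      (∀ d, w.Marked d ↔ (brd g sc (2 * i) v).Marked d ∨
        6 * n < i ∧ ∃ a ∈ P, ∃ m, mem g sc (2 * i) a = some m ∧ node g sc i a = v ∧
          node g sc i a ≠ node g sc (i - 1) a ∧ m.dir = d ∧ d ≠ 0) ∧
      (w.dir ≠ 0 → w.Marked w.dir) ∧ ∀ d, w.waiting = true → w.Marked d → w.dir ≠ 0)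
    (s' := fun a =>
      (trans k g (sc.ident a) (mem g sc (2 * i) a) (brd g sc (2 * i) (node g sc i a))).1)
    (mv := fun _ => 0) ?_ ?_ ?_
  · obtain ⟨k1, k2, k3⟩ := key
    exact {
      mem := k1
      pos := k2
      stamp := fun v => by simpa using (k3 v).1
      done := fun v => (k3 v).2.1
      waiting := fun v => (k3 v).2.2.1
      id := fun v => by simpa using (k3 v).2.2.2.1
      marked := fun v => by simpa using (k3 v).2.2.2.2.1
      dir_marked := fun v => (k3 v).2.2.2.2.2.1
      waiting_dir := fun v => (k3 v).2.2.2.2.2.2 }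
  · intro v
    refine ⟨by simp, rfl, rfl, ⟨fun _ => rfl, fun h0 x => ?_⟩, by simp, h.dir_marked v,
      h.waiting_dir v⟩
    simp [(h.first h0).2.2 v]
  · rintro a P w haP ⟨⟨i1, i2⟩, i3, i4, ⟨i5, i6⟩, i7, i8, i9⟩
    rcases hm : mem g sc (2 * i) a with _ | m
    · refine ⟨by simp, by simp, ?_⟩
      simp only [trans_none]
      refine ⟨⟨?_, ?_⟩, i3, i4, ⟨i5, fun h0 => ?_⟩, fun d => ?_, i8, i9⟩
      · intro b hb m hbm
        rcases Finset.mem_insert.1 hb with rfl | hb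
        · rw [hm] at hbm
          cases hbm
        · exact i1 b hb m hbm
      · exact fun x hx => i2 x fun b hb => hx b (Finset.mem_insert_of_mem hb)
      · obtain ⟨m, hm'⟩ := (h.first h0).2.1 a
        rw [hm] at hm'
        cases hm'
      · rw [i7 d]
        refine or_congr_right (and_congr_right fun _ => ?_)
        simp [hm]
    · obtain ⟨hr, hs⟩ := h.rounds a m hm
      have ht : ∀ w, trans k g (sc.ident a) (some m) w = signIn k (sc.ident a) m w := by
        intro w
        simp [trans_some, hs]
      simp only [ht]
      have hst : w.stamp (sc.ident a) =
          (brd g sc (2 * i) (node g sc i a)).stamp (sc.ident a) := by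
        refine i2 _ fun b hb m' _ _ hba => ?_
        rw [sc.ident.injective hba] at hb
        exact haP hb
      have hre : (w.stamp (sc.ident a) : ℕ) + 1 ≠ m.rounds ↔
          node g sc i a ≠ node g sc (i - 1) a := by
        rw [hst, hr, ne_eq, Nat.add_right_cancel_iff, h.stamp_iff a m hm]
      obtain ⟨b1, b2, b3, b4⟩ := signIn_board (k := k) (x := sc.ident a) (m := m) (w := w)
      have b5 := signIn_dir (k := k) (x := sc.ident a) (m := m) (w := w)
      have b6 := fun d => signIn_marked (k := k) (x := sc.ident a) (m := m) (w := w) (d := d)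
      have hr' : (m.rounds : ℕ) = 1 ↔ i = 0 := by omega
      refine ⟨?_, signIn_move, ⟨?_, ?_⟩, b2.trans i3, b3.trans i4, ⟨?_, ?_⟩, ?_, ?_, ?_⟩
      · by_cases h0 : i = 0
        · rw [signIn_first (hr'.2 h0), signIn_first (hr'.2 h0), hst]
        · rw [signIn_later (mt hr'.1 h0), signIn_later (mt hr'.1 h0), hst, i5 h0]
      · intro b hb m' hm' hv
        rw [b1]
        by_cases hba : b = a
        · subst hba
          rw [Function.update_self, hr]
        · rw [Function.update_of_ne (fun e => hba (sc.ident.injective e))]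
          exact i1 b (Finset.mem_of_mem_insert_of_ne hb hba) m' hm' hv
      · intro x hx
        have hxa : x ≠ sc.ident a := (hx a (Finset.mem_insert_self _ _) m hm rfl).symm
        rw [b1, Function.update_of_ne hxa]
        exact i2 x fun b hb => hx b (Finset.mem_insert_of_mem hb)
      · intro h0
        rw [b4, if_neg (mt hr'.1 h0), i5 h0]
      · intro h0 x
        rw [b4, if_pos (hr'.2 h0), Option.some.injEq]
        constructor
        · exact fun e => ⟨a, Finset.mem_insert_self _ _, rfl, e⟩
        · rintro ⟨b, _, hb, rfl⟩
          have : b = a := sc.home.injective (by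
            rw [← (h.first h0).1, ← (h.first h0).1]
            exact hb)
          rw [this]
      · intro d
        rw [b6, i7, hre, hr, or_assoc]
        refine or_congr_right ?_
        constructor
        · rintro (⟨c1, b, hb, c2⟩ | ⟨c1, c2, c3, c4⟩)
          · exact ⟨c1, b, Finset.mem_insert_of_mem hb, c2⟩
          · exact ⟨by omega, a, Finset.mem_insert_self _ _, m, hm, rfl, c2, c3, c4⟩
        · rintro ⟨c1, b, hb, m', c2, c3, c4, c5, c6⟩
          rcases Finset.mem_insert.1 hb with rfl | hb
          · rw [hm] at c2
            cases c2
            exact Or.inr ⟨by omega, c4, c5, c6⟩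
          · exact Or.inl ⟨c1, b, hb, m', c2, c3, c4, c5, c6⟩
      · intro hd
        rw [b6]
        rw [b5] at hd ⊢
        split_ifs at hd ⊢ with hc
        · exact Or.inr ⟨hc.1, hc.2.1, rfl, hd⟩
        · exact Or.inl (i8 hd)
      · intro d hw hd
        rw [b3] at hw
        rw [b6] at hd
        rw [b5]
        split_ifs with hc
        · rcases hd with hd | hd
          · exact absurd hc.2.2 (i9 d hw hd)
          · rw [hd.2.2.1]
            exact hd.2.2.2
        · rcases hd with hd | hd
          · exact i9 d hw hd
          · exact fun h0 => hc ⟨hd.1, hd.2.1, h0⟩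
  · rintro v a P w haP hv ⟨⟨i1, i2⟩, i3, i4, ⟨i5, i6⟩, i7, i8, i9⟩
    refine ⟨⟨?_, ?_⟩, i3, i4, ⟨i5, fun h0 x => ?_⟩, fun d => ?_, i8, i9⟩
    · intro b hb m hbm hbv
      rcases Finset.mem_insert.1 hb with rfl | hb
      · exact absurd hbv hv
      · exact i1 b hb m hbm hbv
    · exact fun x hx => i2 x fun b hb => hx b (Finset.mem_insert_of_mem hb)
    · rw [i6 h0]
      simp [hv]
    · rw [i7]
      simp [hv]

/-- The memory of an agent after the first round of an iteration. -/
theorem StartInv.mem_signed [NeZero n] {i : ℕ} (h : StartInv g sc i) {a : Fin k}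
    {m : Memory ID n} (hm : mem g sc (2 * i) a = some m) : ∃ m', mem g sc (2 * i + 1) a = some m' ∧
      (m'.rounds : ℕ) = i + 1 ∧ m'.signed = true ∧ m'.dir = m.dir ∧
      (m'.reached = true ↔ node g sc i a ≠ node g sc (i - 1) a) ∧
      (i = 0 → m'.nVisited = m.nVisited ∧ m'.ids = {sc.ident a}) ∧
      (i ≠ 0 → i ≤ 3 * n →
        m'.nVisited = (if node g sc i a ≠ node g sc (i - 1) a then bump m.nVisited
          else m.nVisited) ∧
        m'.ids = if node g sc i a ≠ node g sc (i - 1) a ∧ m.ids.card < k then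
          m.ids ∪ (brd g sc (2 * i) (node g sc i a)).id.toFinset else m.ids) ∧
      (3 * n < i → m'.nVisited = m.nVisited ∧ m'.ids = m.ids) := by
  obtain ⟨hr, hs⟩ := h.rounds a m hm
  have hre : ((brd g sc (2 * i) (node g sc i a)).stamp (sc.ident a) : ℕ) + 1 ≠ m.rounds ↔
      node g sc i a ≠ node g sc (i - 1) a := by
    rw [hr, ne_eq, Nat.add_right_cancel_iff, h.stamp_iff a m hm]
  have key := h.signSpec.mem a
  rw [hm, trans_some, hs, if_neg (by decide)] at key
  have hr' : (m.rounds : ℕ) = 1 ↔ i = 0 := by omega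
  by_cases h0 : i = 0
  · rw [signIn_first (hr'.2 h0)] at key
    refine ⟨_, key, hr, rfl, rfl, ?_, fun _ => ⟨rfl, rfl⟩, fun h => absurd h0 h,
      fun h => absurd h (by omega)⟩
    rw [decide_eq_true_eq, hre]
  · rw [signIn_later (mt hr'.1 h0)] at key
    refine ⟨_, key, hr, rfl, rfl, ?_, fun h => absurd h h0, fun _ hi => ?_, fun hi => ?_⟩
    · rw [decide_eq_true_eq, hre]
    · have : (m.rounds : ℕ) ≤ 3 * n + 1 := by omega
      simp only [hre, this, and_true, true_and]
    · have : ¬ (m.rounds : ℕ) ≤ 3 * n + 1 := by omega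
      simp only [this, and_false, false_and, if_false, and_self]

theorem StartInv.mem_signed_none [NeZero n] {i : ℕ} (_ : StartInv g sc i) {a : Fin k} :
    mem g sc (2 * i + 1) a = none ↔ mem g sc (2 * i) a = none := by
  refine ⟨fun h => ?_, fun h => (dead_succ h).1⟩
  rcases hm : mem g sc (2 * i) a with _ | m
  · rfl
  · obtain ⟨m', h', _⟩ := StartInv.mem_signed ‹_› hm
    rw [h] at h'
    cases h'

theorem StartInv.of_mem_signed [NeZero n] {i : ℕ} (h : StartInv g sc i) {a : Fin k}
    {m' : Memory ID n} (hm : mem g sc (2 * i + 1) a = some m') :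
    ∃ m, mem g sc (2 * i) a = some m ∧ m'.dir = m.dir := by
  rcases h0 : mem g sc (2 * i) a with _ | m
  · rw [h.mem_signed_none.2 h0] at hm
    cases hm
  · obtain ⟨m₁, h1, _, _, h2, _⟩ := h.mem_signed h0
    rw [hm] at h1
    cases h1
    exact ⟨m, rfl, h2⟩

theorem StartInv.signedInv [NeZero n] {i : ℕ} (h : StartInv g sc i) : SignedInv g sc i := by
  have hs := h.signSpec
  have hsome : ∀ {a m'}, mem g sc (2 * i + 1) a = some m' →
      ∃ m, mem g sc (2 * i) a = some m ∧ (m'.rounds : ℕ) = i + 1 ∧ m'.signed = true ∧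
        m'.dir = m.dir ∧ (m'.reached = true ↔ node g sc i a ≠ node g sc (i - 1) a) := by
    intro a m' h'
    obtain ⟨m, hm, _⟩ := h.of_mem_signed h'
    obtain ⟨m₁, h1, h2, h3, h4, h5, _⟩ := h.mem_signed hm
    rw [h'] at h1
    cases h1
    exact ⟨m, hm, h2, h3, h4, h5⟩
  refine {
    rounds := fun a m hm => ?_
    pos := hs.pos
    stamp_le := fun v x => ?_
    stamp_iff := fun v x => ?_
    done := fun v x => ?_
    id := fun v x => ?_
    reached := fun a m hm => ?_
    early_dir := fun hi a m' hm' => ?_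
    early := fun hi v => ?_
    marked := fun a m' hm' hd => ?_
    dir_marked := hs.dir_marked
    waiting_dir := hs.waiting_dir }
  · obtain ⟨_, _, h1, h2, _⟩ := hsome hm
    exact ⟨h1, h2⟩
  · by_cases hx : ∃ a m, mem g sc (2 * i) a = some m ∧ node g sc i a = v ∧ sc.ident a = x
    · obtain ⟨a, m, h1, h2, rfl⟩ := hx
      exact ((hs.stamp v).1 a m h1 h2).le
    · push Not at hx
      rw [(hs.stamp v).2 x hx]
      exact (h.stamp_le v x).trans (Nat.le_succ _)
  · constructor
    · intro he
      by_contra hx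
      have hx' : ∀ a m, mem g sc (2 * i) a = some m → node g sc i a = v → sc.ident a ≠ x := by
        intro a m h1 h2 h3
        obtain ⟨m', h4, _⟩ := h.mem_signed h1
        exact hx ⟨a, m', h3, h4, h2⟩
      rw [(hs.stamp v).2 x hx'] at he
      have := h.stamp_le v x
      omega
    · rintro ⟨a, m', rfl, h1, h2⟩
      obtain ⟨m, hm, _⟩ := h.of_mem_signed h1
      exact (hs.stamp v).1 a m hm h2
  · rw [hs.done, h.done]
    simp only [h.mem_signed_none]
  · by_cases h0 : i = 0
    · rw [(hs.id v).2 h0]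
      simp only [(h.first h0).1]
    · rw [(hs.id v).1 h0, h.id h0]
  · obtain ⟨_, _, _, _, _, h2⟩ := hsome hm
    exact h2
  · obtain ⟨m, hm, h1⟩ := h.of_mem_signed hm'
    rw [h1]
    exact h.early_dir hi a m hm
  · refine ⟨(hs.waiting v).trans (h.early hi v).1, fun d hd => ?_⟩
    rcases (hs.marked v d).1 hd with hd | hd
    · exact (h.early hi v).2 d hd
    · omega
  · obtain ⟨m, hm, h1⟩ := h.of_mem_signed hm'
    rw [h1] at hd ⊢
    have hi : 6 * n < i := by
      by_contra hi
      exact hd (h.early_dir (not_lt.1 hi) a m hm)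
    rw [hs.marked]
    refine (h.moves hi a m hm hd).imp_right fun h2 => ⟨hi, a, m, hm, rfl, h2, rfl, hd⟩

/-- The agents that are at the node `v` in the iteration number `i`. -/
noncomputable def agents (g : ℕ) (sc : Scenario ID n k) (i : ℕ) (v : ZMod n) : Finset (Fin k) :=
  Finset.univ.filter fun a => node g sc i a = v

@[simp] theorem mem_agents {i : ℕ} {v : ZMod n} {a : Fin k} :
    a ∈ agents g sc i v ↔ node g sc i a = v := by
  simp [agents]

/-- The signatures and the terminated agents together are the agents at the node. -/
theorem SignedInv.present_eq {i : ℕ} (h : SignedInv g sc i) (v : ZMod n) {r : Fin (7 * n + 2)}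
    (hr : (r : ℕ) = i + 1) :
    present (brd g sc (2 * i + 1) v) r = (agents g sc i v).map sc.ident := by
  ext x
  simp only [present, Finset.mem_filter, Finset.mem_univ, true_and, Finset.mem_map, mem_agents,
    ← Fin.val_inj, hr, h.stamp_iff, h.done]
  constructor
  · rintro (⟨a, m, rfl, h1, h2⟩ | ⟨a, rfl, h1, h2⟩)
    · exact ⟨a, h2, rfl⟩
    · exact ⟨a, h2, rfl⟩
  · rintro ⟨a, h1, rfl⟩
    rcases hm : mem g sc (2 * i + 1) a with _ | m
    · exact Or.inr ⟨a, rfl, hm, h1⟩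
    · exact Or.inl ⟨a, m, rfl, hm, h1⟩

theorem SignedInv.nAgents_eq {i : ℕ} (h : SignedInv g sc i) (v : ZMod n) {m : Memory ID n}
    (hr : (m.rounds : ℕ) = i + 1) :
    nAgents m (brd g sc (2 * i + 1) v) = (agents g sc i v).card := by
  rw [nAgents, h.present_eq v hr, Finset.card_map]

/-- The rank of the agent `a` among the agents at the node `v`. -/
noncomputable def rankAt (g : ℕ) (sc : Scenario ID n k) (i : ℕ) (v : ZMod n) (a : Fin k) : ℕ :=
  ((agents g sc i v).filter fun b => sc.ident b ≤ sc.ident a).card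

theorem SignedInv.rank_eq {i : ℕ} (h : SignedInv g sc i) (v : ZMod n) {m : Memory ID n}
    (hr : (m.rounds : ℕ) = i + 1) (a : Fin k) :
    rank (sc.ident a) m (brd g sc (2 * i + 1) v) = rankAt g sc i v a := by
  rw [rank, h.present_eq v hr, rankAt, Finset.filter_map, Finset.card_map]
  rfl

theorem card_rankAt_le (i : ℕ) (v : ZMod n) (j : ℕ) :
    ((agents g sc i v).filter fun a => rankAt g sc i v a ≤ j).card =
      min j (agents g sc i v).card := by
  rw [← Finset.card_map sc.ident (s := agents g sc i v), ← card_filter_rank_le,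
    Finset.filter_map, Finset.card_map]
  congr 1
  refine Finset.filter_congr fun a _ => ?_
  simp only [Function.comp_apply, Finset.filter_map, Finset.card_map]
  rfl

/-- The second round of an iteration. -/
structure ActSpec (g : ℕ) (sc : Scenario ID n k) (i : ℕ) : Prop where
  mem : ∀ a, mem g sc (2 * (i + 1)) a =
    (trans k g (sc.ident a) (mem g sc (2 * i + 1) a) (brd g sc (2 * i + 1) (node g sc i a))).1
  node : ∀ a, node g sc (i + 1) a = hop (sc.missing (2 * i + 1)) (node g sc i a)
    (trans k g (sc.ident a) (SmallK.mem g sc (2 * i + 1) a)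
      (brd g sc (2 * i + 1) (node g sc i a))).2.2
  id : ∀ v, (brd g sc (2 * (i + 1)) v).id = (brd g sc (2 * i + 1) v).id
  stamp : ∀ v, (brd g sc (2 * (i + 1)) v).stamp = (brd g sc (2 * i + 1) v).stamp
  dir : ∀ v, (brd g sc (2 * (i + 1)) v).dir = (brd g sc (2 * i + 1) v).dir
  done : ∀ v x, x ∈ (brd g sc (2 * (i + 1)) v).done ↔ x ∈ (brd g sc (2 * i + 1) v).done ∨
    ∃ a m, SmallK.mem g sc (2 * i + 1) a = some m ∧ SmallK.node g sc i a = v ∧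
      SmallK.mem g sc (2 * (i + 1)) a = none ∧ sc.ident a = x
  waiting : ∀ v, (brd g sc (2 * (i + 1)) v).waiting = true ↔
    (brd g sc (2 * i + 1) v).waiting = true ∨
    ∃ a m, SmallK.mem g sc (2 * i + 1) a = some m ∧ SmallK.node g sc i a = v ∧
      i = 6 * n ∧ (agents g sc i v).card < g
  marked : ∀ v d, (brd g sc (2 * (i + 1)) v).Marked d ↔ (brd g sc (2 * i + 1) v).Marked d ∨
    ∃ a m, SmallK.mem g sc (2 * i + 1) a = some m ∧ SmallK.node g sc i a = v ∧
      ∃ m', SmallK.mem g sc (2 * (i + 1)) a = some m' ∧ m'.dir = d ∧ d ≠ 0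

theorem SignedInv.actSpec [NeZero n] {i : ℕ} (h : SignedInv g sc i) : ActSpec g sc i := by
  have key := round_spec (g := g) (sc := sc) (t := 2 * i + 1)
    (s' := fun a => (trans k g (sc.ident a) (mem g sc (2 * i + 1) a)
      (brd g sc (2 * i + 1) (node g sc i a))).1)
    (mv := fun a => (trans k g (sc.ident a) (mem g sc (2 * i + 1) a)
      (brd g sc (2 * i + 1) (node g sc i a))).2.2)
    (Inv := fun v P w =>
      w.id = (brd g sc (2 * i + 1) v).id ∧
      w.stamp = (brd g sc (2 * i + 1) v).stamp ∧
      w.dir = (brd g sc (2 * i + 1) v).dir ∧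
      (∀ x, x ∈ w.done ↔ x ∈ (brd g sc (2 * i + 1) v).done ∨
        ∃ a ∈ P, ∃ m, mem g sc (2 * i + 1) a = some m ∧ node g sc i a = v ∧
          (trans k g (sc.ident a) (mem g sc (2 * i + 1) a)
            (brd g sc (2 * i + 1) (node g sc i a))).1 = none ∧ sc.ident a = x) ∧
      (w.waiting = true ↔ (brd g sc (2 * i + 1) v).waiting = true ∨
        ∃ a ∈ P, ∃ m, mem g sc (2 * i + 1) a = some m ∧ node g sc i a = v ∧
          i = 6 * n ∧ (agents g sc i v).card < g) ∧
      ∀ d, w.Marked d ↔ (brd g sc (2 * i + 1) v).Marked d ∨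
        ∃ a ∈ P, ∃ m, mem g sc (2 * i + 1) a = some m ∧ node g sc i a = v ∧
          ∃ m', (trans k g (sc.ident a) (mem g sc (2 * i + 1) a)
            (brd g sc (2 * i + 1) (node g sc i a))).1 = some m' ∧ m'.dir = d ∧ d ≠ 0) ?_ ?_ ?_
  · obtain ⟨k1, k2, k3⟩ := key
    have k1' : ∀ a, mem g sc (2 * (i + 1)) a = (trans k g (sc.ident a) (mem g sc (2 * i + 1) a)
      (brd g sc (2 * i + 1) (node g sc i a))).1 := k1
    exact {
      mem := k1'
      node := fun a => by
        rw [← h.pos a]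
        exact (k2 a).trans (by rw [h.pos a])
      id := fun v => (k3 v).1
      stamp := fun v => (k3 v).2.1
      dir := fun v => (k3 v).2.2.1
      done := fun v x => by
        simp only [k1']
        rw [show 2 * (i + 1) = 2 * i + 1 + 1 from rfl]
        simpa using (k3 v).2.2.2.1 x
      waiting := fun v => by
        rw [show 2 * (i + 1) = 2 * i + 1 + 1 from rfl]
        simpa using (k3 v).2.2.2.2.1
      marked := fun v d => by
        simp only [k1']
        rw [show 2 * (i + 1) = 2 * i + 1 + 1 from rfl]
        simpa using (k3 v).2.2.2.2.2 d }
  · intro v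
    simp
  · rintro a P w haP ⟨i1, i2, i3, i4, i5, i6⟩
    rw [h.pos a] at i1 i2 i3 i4 i5 i6 ⊢
    rcases hm : mem g sc (2 * i + 1) a with _ | m
    · refine ⟨by simp, by simp, ?_⟩
      simp only [trans_none]
      refine ⟨i1, i2, i3, fun x => ?_, ?_, fun d => ?_⟩
      · rw [i4 x]
        simp [hm]
      · rw [i5]
        simp [hm]
      · rw [i6]
        simp [hm]
    · obtain ⟨hr, hs⟩ := h.rounds a m hm
      have ht : ∀ w, trans k g (sc.ident a) (some m) w = act g (sc.ident a) m w := by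
        intro w
        simp [trans_some, hs]
      simp only [ht]
      have hp : present w m.rounds = present (brd g sc (2 * i + 1) (node g sc i a)) m.rounds := by
        ext x
        simp only [present, Finset.mem_filter, Finset.mem_univ, true_and, i2, i4]
        refine ⟨?_, fun hx => hx.imp_right Or.inl⟩
        rintro (hx | hx | ⟨b, hb, m', h1, h2, h3, rfl⟩)
        · exact Or.inl hx
        · exact Or.inr hx
        · left
          rw [← Fin.val_inj, hr, h.stamp_iff]
          exact ⟨b, m', rfl, h1, h2⟩
      have hmk : 6 * n + 1 < (m.rounds : ℕ) → ∀ d, w.Marked d ↔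
          (brd g sc (2 * i + 1) (node g sc i a)).Marked d := by
        intro hr' d
        rw [i6]
        refine ⟨?_, Or.inl⟩
        rintro (hx | ⟨b, hb, m₁, h1, h2, m', h3, h4, h5⟩)
        · exact hx
        · obtain ⟨hr₁, hs₁⟩ := h.rounds b m₁ h1
          rw [h1, trans_some, hs₁, if_pos rfl] at h3
          rw [← h2, ← h4]
          refine act_dir_marked (by omega) (h.marked b m₁ h1) (h.dir_marked _) h3 ?_
          rw [h4]
          exact h5
      have hsv : SameView m.rounds w (brd g sc (2 * i + 1) (node g sc i a)) := by
        refine ⟨i1, hp, fun hr' => ?_, fun hr' => ?_, fun hr' => ?_, fun _ => i3⟩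
        · rw [Bool.eq_iff_iff, ← Board.marked_one, ← Board.marked_one, hmk hr']
        · rw [Bool.eq_iff_iff, ← Board.marked_neg_one, ← Board.marked_neg_one, hmk hr']
        · rw [Bool.eq_iff_iff, i5]
          refine ⟨?_, Or.inl⟩
          rintro (hx | ⟨b, hb, m₁, h1, h2, h3, h4⟩)
          · exact hx
          · omega
      obtain ⟨c1, c2⟩ := act_congr (g := g) (x := sc.ident a) hsv
      obtain ⟨b1, b2, b3, b4, b5⟩ := act_board (g := g) (x := sc.ident a) (m := m) (w := w)
      have b6 := fun d => act_marked (g := g) (x := sc.ident a) (m := m) (w := w)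
        (fun h0 => h.early_dir (by omega) a m hm) (d := d)
      refine ⟨c1, c2, b1.trans i1, b2.trans i2, b3.trans i3, fun x => ?_, ?_, fun d => ?_⟩
      · rw [b4, c1]
        simp only [Finset.mem_insert, exists_eq_or_imp, hm, ht, Option.some.injEq,
          exists_eq_left', true_and]
        split_ifs with h0
        · simp only [h0, true_and, Finset.mem_insert, i4, eq_comm (a := x)]
          exact or_left_comm
        · simp only [h0, false_and, false_or, i4]
      · rw [b5]
        simp only [Finset.mem_insert, exists_eq_or_imp, hm, Option.some.injEq,
          exists_eq_left', true_and]
        have : nAgents m w = (agents g sc i (node g sc i a)).card := by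
          rw [← h.nAgents_eq _ hr, nAgents, nAgents, hp]
        rw [i5, this, hr, Nat.add_right_cancel_iff]
        exact or_assoc.trans (or_congr_right or_comm)
      · rw [b6, i6, c1]
        simp only [Finset.mem_insert, exists_eq_or_imp, hm, ht, Option.some.injEq,
          exists_eq_left', true_and]
        exact or_assoc.trans (or_congr_right or_comm)
  · rintro v a P w haP hv ⟨i1, i2, i3, i4, i5, i6⟩
    rw [h.pos a] at hv
    refine ⟨i1, i2, i3, fun x => ?_, ?_, fun d => ?_⟩
    · rw [i4 x]
      simp [hv]
    · rw [i5]
      simp [hv]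
    · rw [i6]
      simp [hv]

theorem SignedInv.mem_succ [NeZero n] {i : ℕ} (h : SignedInv g sc i) {a : Fin k}
    {m : Memory ID n} (hm : mem g sc (2 * i + 1) a = some m) :
    mem g sc (2 * (i + 1)) a =
      (act g (sc.ident a) m (brd g sc (2 * i + 1) (node g sc i a))).1 ∧
    node g sc (i + 1) a = hop (sc.missing (2 * i + 1)) (node g sc i a)
      (act g (sc.ident a) m (brd g sc (2 * i + 1) (node g sc i a))).2.2 := by
  have h1 := h.actSpec.mem a
  have h2 := h.actSpec.node a
  rw [hm, trans_some, (h.rounds a m hm).2, if_pos rfl] at h1 h2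
  exact ⟨h1, h2⟩

/-- Terminating agents do not move. -/
theorem SignedInv.node_succ_of_none [NeZero n] {i : ℕ} (h : SignedInv g sc i) {a : Fin k}
    (h0 : mem g sc (2 * (i + 1)) a = none) : node g sc (i + 1) a = node g sc i a := by
  rcases hm : mem g sc (2 * i + 1) a with _ | m
  · rw [h.actSpec.node a, hm]
    rfl
  · obtain ⟨h1, h2⟩ := h.mem_succ hm
    rw [h2, act_move_of_eq_none (h1 ▸ h0)]
    rfl

theorem SignedInv.startInv_succ [NeZero n] {i : ℕ} (h : SignedInv g sc i) (hi : i < 7 * n) :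
    StartInv g sc (i + 1) := by
  have hs := h.actSpec
  have hsome : ∀ {a m'}, mem g sc (2 * (i + 1)) a = some m' →
      ∃ m, mem g sc (2 * i + 1) a = some m ∧ (m.rounds : ℕ) = i + 1 ∧
        (act g (sc.ident a) m (brd g sc (2 * i + 1) (node g sc i a))).1 = some m' ∧
        node g sc (i + 1) a = hop (sc.missing (2 * i + 1)) (node g sc i a)
          (act g (sc.ident a) m (brd g sc (2 * i + 1) (node g sc i a))).2.2 := by
    intro a m' hm'
    rcases hm : mem g sc (2 * i + 1) a with _ | m
    · have := (dead_succ hm).1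
      rw [show 2 * i + 1 + 1 = 2 * (i + 1) from rfl, hm'] at this
      cases this
    · obtain ⟨h1, h2⟩ := h.mem_succ hm
      exact ⟨m, rfl, (h.rounds a m hm).1, h1 ▸ hm', h2⟩
  have hmono : ∀ {v d}, (brd g sc (2 * i + 1) v).Marked d → (brd g sc (2 * (i + 1)) v).Marked d :=
    fun hd => (hs.marked _ _).2 (Or.inl hd)
  refine {
    rounds := fun a m' hm' => ?_
    first := fun h0 => absurd h0 (by omega)
    stamp_le := fun v x => ?_
    stamp_iff := fun a m' hm' => ?_
    done := fun v x => ?_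
    id := fun _ v x => ?_
    early_dir := fun hi' a m' hm' => ?_
    early := fun hi' v => ?_
    stays := fun hi' a m' hm' hd => ?_
    moves := fun hi' a m' hm' hd => ?_
    dir_marked := fun v hv => ?_
    waiting_dir := fun v d hw hd => ?_ }
  · obtain ⟨m, hm, hr, h1, _⟩ := hsome hm'
    obtain ⟨e1, e2, _⟩ := act_eq_some h1
    refine ⟨?_, e2⟩
    rw [e1]
    simp only [bump, hr]
    omega
  · rw [hs.stamp]
    exact h.stamp_le v x
  · obtain ⟨m, hm, _⟩ := hsome hm'
    rw [hs.stamp, h.stamp_iff, Nat.add_sub_cancel]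
    constructor
    · rintro ⟨b, m₁, hb, _, h2⟩
      rw [sc.ident.injective hb] at h2
      exact h2.symm
    · exact fun h2 => ⟨a, m, rfl, hm, h2.symm⟩
  · rw [hs.done, h.done]
    constructor
    · rintro (⟨a, rfl, h1, rfl⟩ | ⟨a, m, hm, rfl, h1, rfl⟩)
      · have h2 : mem g sc (2 * (i + 1)) a = none := (dead_succ h1).1
        exact ⟨a, rfl, h2, h.node_succ_of_none h2⟩
      · exact ⟨a, rfl, h1, h.node_succ_of_none h1⟩
    · rintro ⟨a, rfl, h1, rfl⟩
      rcases hm : mem g sc (2 * i + 1) a with _ | m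
      · exact Or.inl ⟨a, rfl, hm, (h.node_succ_of_none h1).symm⟩
      · exact Or.inr ⟨a, m, hm, (h.node_succ_of_none h1).symm, h1, rfl⟩
  · rw [hs.id, h.id]
  · obtain ⟨m, hm, hr, h1, _⟩ := hsome hm'
    rw [(act_eq_some h1).2.2.2.2 (by omega)]
    exact h.early_dir (by omega) a m hm
  · constructor
    · rw [Bool.eq_false_iff, ne_eq, hs.waiting, (h.early (by omega) v).1]
      rintro (h0 | ⟨_, _, _, _, h0, _⟩)
      · cases h0
      · omega
    · intro d
      rw [hs.marked]
      rintro (h0 | ⟨a, m, hm, _, m', h1, rfl, h2⟩)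
      · exact (h.early (by omega) v).2 d h0
      · obtain ⟨m₁, hm₁, hr, h3, _⟩ := hsome h1
        rw [(act_eq_some h3).2.2.2.2 (by omega)] at h2
        exact h2 (h.early_dir (by omega) a m₁ hm₁)
  · obtain ⟨m, hm, hr, h1, h2⟩ := hsome hm'
    rw [h2, act_move_eq_dir (by omega) (fun _ => h.early_dir (by omega) a m hm) h1, hd]
    rfl
  · obtain ⟨m, hm, hr, h1, h2⟩ := hsome hm'
    by_cases hn : node g sc (i + 1) a = node g sc i a
    · left
      rw [hs.marked, hn]
      exact Or.inr ⟨a, m, hm, rfl, m', hm', rfl, hd⟩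
    · exact Or.inr hn
  · rw [hs.dir] at hv ⊢
    exact hmono (h.dir_marked v hv)
  · rw [hs.dir]
    rw [hs.waiting] at hw
    rw [hs.marked] at hd
    rcases lt_trichotomy i (6 * n) with h6 | h6 | h6
    · rw [(h.early h6.le v).1] at hw
      rcases hw with h0 | ⟨_, _, _, _, h0, _⟩
      · cases h0
      · omega
    · rw [(h.early h6.le v).1] at hw
      rcases hw with h0 | ⟨a, m, hm, rfl, _, h0⟩
      · cases h0
      rcases hd with hd | ⟨b, m₁, hb, hv, m', hm', rfl, hd⟩
      · exact absurd hd ((h.early h6.le _).2 d)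
      · obtain ⟨m₂, hm₂, hr, h3, _⟩ := hsome hm'
        exfalso
        rcases act_cases (g := g) (x := sc.ident b) (m := m₂)
            (w := brd g sc (2 * i + 1) (node g sc i b)) with
          ⟨e, _⟩ | ⟨mv, _, _⟩ | ⟨e, h1, _⟩ | ⟨d, e, _, _, h4⟩ | ⟨e, h2, _⟩
        · simp [e, terminate] at h3
        · omega
        · rw [e] at h3
          cases h3
          exact hd (h.early_dir h6.le b m₂ hm₂)
        · rw [h.nAgents_eq _ hr, hv] at h4
          exact h4 ⟨by omega, h0⟩
        · omega
    · have hw' : (brd g sc (2 * i + 1) v).waiting = true := by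
        rcases hw with h0 | ⟨_, _, _, _, h0, _⟩
        · exact h0
        · omega
      refine h.waiting_dir v d hw' ?_
      rcases hd with hd | ⟨b, m₁, hb, rfl, m', hm', rfl, hd⟩
      · exact hd
      · obtain ⟨m₂, hm₂, hr, h3, _⟩ := hsome hm'
        exact act_dir_marked (by omega) (h.marked b m₂ hm₂) (h.dir_marked _) h3 hd

theorem startInv [NeZero n] {i : ℕ} (hi : i ≤ 7 * n) : StartInv g sc i := by
  induction i with
  | zero => exact startInv_zero
  | succ i ih => exact (ih (by omega)).signedInv.startInv_succ (by omega)

theorem signedInv [NeZero n] {i : ℕ} (hi : i ≤ 7 * n) : SignedInv g sc i :=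
  (startInv hi).signedInv

end Iterations

end SmallK

/-! ### Walks in a ring with a missing link -/

section Walks

variable {n : ℕ}

@[simp] theorem hop_zero (e : Option (ZMod n)) (v : ZMod n) : hop e v 0 = v := rfl

theorem hop_one (e : Option (ZMod n)) (v : ZMod n) :
    hop e v 1 = if e = some v then v else v + 1 := rfl

theorem hop_neg_one (e : Option (ZMod n)) (v : ZMod n) :
    hop e v (-1) = if e = some (v - 1) then v else v - 1 := rfl

/-- The number of moves in the first `i` steps of a walk. -/
def walkMoves (x : ℕ → ZMod n) (i : ℕ) : ℕ :=
  ((Finset.range i).filter fun j => x (j + 1) ≠ x j).card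

@[simp] theorem walkMoves_zero (x : ℕ → ZMod n) : walkMoves x 0 = 0 := by simp [walkMoves]

theorem walkMoves_succ (x : ℕ → ZMod n) (i : ℕ) :
    walkMoves x (i + 1) = walkMoves x i + if x (i + 1) ≠ x i then 1 else 0 := by
  rw [walkMoves, Finset.range_add_one, Finset.filter_insert]
  split_ifs with h
  · rw [Finset.card_insert_of_notMem (by simp), walkMoves]
  · rfl

/-- The walk `x` tries to move forward in each of its first `T` steps, where `e i` is the link
that is missing in the step number `i`. -/
def ForwardWalk (e : ℕ → Option (ZMod n)) (T : ℕ) (x : ℕ → ZMod n) : Prop :=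
  ∀ i < T, x (i + 1) = hop (e i) (x i) 1

variable {e : ℕ → Option (ZMod n)} {T : ℕ} {x y : ℕ → ZMod n}

theorem add_one_ne_self (hn : 1 < n) (v : ZMod n) : v + 1 ≠ v := by
  have : Fact (1 < n) := ⟨hn⟩
  simp

theorem ForwardWalk.succ (hn : 1 < n) (hx : ForwardWalk e T x) {i : ℕ} (hi : i < T) :
    (e i = some (x i) ∧ x (i + 1) = x i ∧ walkMoves x (i + 1) = walkMoves x i) ∨
      (e i ≠ some (x i) ∧ x (i + 1) = x i + 1 ∧ walkMoves x (i + 1) = walkMoves x i + 1) := by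
  have h := hx i hi
  rw [hop_one] at h
  rw [walkMoves_succ]
  split_ifs at h with he
  · simp [h, he]
  · refine Or.inr ⟨he, h, ?_⟩
    rw [h, if_pos (add_one_ne_self hn _)]

theorem ForwardWalk.eq_add (hn : 1 < n) (hx : ForwardWalk e T x) {i : ℕ} (hi : i ≤ T) :
    x i = x 0 + walkMoves x i := by
  induction i with
  | zero => simp
  | succ i ih =>
    rcases hx.succ hn hi with ⟨_, h1, h2⟩ | ⟨_, h1, h2⟩
    · rw [h1, h2]
      exact ih (by omega)
    · rw [h1, h2, ih (by omega)]
      push_cast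
      ring

theorem exists_walkMoves_eq {c : ℕ} (x : ℕ → ZMod n) (hc : c ≤ walkMoves x T) :
    ∃ j ≤ T, walkMoves x j = c := by
  induction T with
  | zero => exact ⟨0, le_rfl, by simpa using hc.antisymm' (by simp)⟩
  | succ T ih =>
    by_cases h : c ≤ walkMoves x T
    · obtain ⟨j, hj, h⟩ := ih h
      exact ⟨j, by omega, h⟩
    · refine ⟨T + 1, le_rfl, ?_⟩
      rw [walkMoves_succ] at hc ⊢
      split_ifs at hc ⊢ <;> omega

/-- A forward walk with `n` moves visits all nodes. -/
theorem ForwardWalk.exists_eq (hn : 1 < n) (hx : ForwardWalk e T x) (h : n ≤ walkMoves x T)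
    (v : ZMod n) : ∃ j ≤ T, x j = v := by
  have : NeZero n := ⟨by omega⟩
  obtain ⟨j, hj, h⟩ := exists_walkMoves_eq (T := T) (c := (v - x 0).val) x
    ((ZMod.val_lt _).le.trans h)
  refine ⟨j, hj, ?_⟩
  rw [hx.eq_add hn hj, h, ZMod.natCast_zmod_val]
  ring

/-- Two forward walks that meet stay together. -/
theorem ForwardWalk.eq_of_eq (hx : ForwardWalk e T x) (hy : ForwardWalk e T y) {i j : ℕ}
    (h : x i = y i) (hij : i ≤ j) (hj : j ≤ T) : x j = y j := by
  induction j, hij using Nat.le_induction with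
  | base => exact h
  | succ j _ ih => rw [hx j hj, hy j hj, ih (by omega)]

/-- A forward walk of `3n` steps with fewer than `n` moves meets every other forward walk: while
they are apart, at least one of them moves in every step, but none of them can overtake the
other. -/
theorem ForwardWalk.eq_of_walkMoves_lt (hn : 1 < n) (hx : ForwardWalk e (3 * n) x)
    (hy : ForwardWalk e (3 * n) y) (h : walkMoves x (3 * n) < n) : x (3 * n) = y (3 * n) := by
  have : NeZero n := ⟨by omega⟩
  by_contra hne
  have hne' : ∀ i ≤ 3 * n, x i ≠ y i := fun i hi h => hne (hx.eq_of_eq hy h hi le_rfl)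
  obtain ⟨d, hd, hyd⟩ : ∃ d : ℕ, d < n ∧ y 0 = x 0 + d :=
    ⟨(y 0 - x 0).val, ZMod.val_lt _, by rw [ZMod.natCast_zmod_val]; ring⟩
  -- The distance from `x` to `y` in forward direction stays strictly between `0` and `n`.
  have key : ∀ i ≤ 3 * n, walkMoves x i < d + walkMoves y i ∧
      d + walkMoves y i < walkMoves x i + n ∧ i ≤ walkMoves x i + walkMoves y i := by
    intro i
    induction i with
    | zero =>
      intro h0
      have : d ≠ 0 := by
        rintro rfl
        exact hne' 0 h0 (by simp [hyd])
      simp only [walkMoves_zero]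
      omega
    | succ i ih =>
      intro hi
      have ih := ih (by omega)
      have h1 : walkMoves x (i + 1) ≠ d + walkMoves y (i + 1) := by
        intro he
        refine hne' (i + 1) hi ?_
        rw [hx.eq_add hn hi, hy.eq_add hn hi, he, hyd]
        push_cast
        ring
      have h2 : d + walkMoves y (i + 1) ≠ walkMoves x (i + 1) + n := by
        intro he
        refine hne' (i + 1) hi ?_
        have he' := congrArg (Nat.cast (R := ZMod n)) he
        push_cast at he'
        rw [ZMod.natCast_self, add_zero] at he'
        rw [hx.eq_add hn hi, hy.eq_add hn hi, ← he', hyd]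
        ring
      rcases hx.succ hn hi with ⟨hx1, _, hx2⟩ | ⟨_, _, hx2⟩ <;>
      rcases hy.succ hn hi with ⟨hy1, _, hy2⟩ | ⟨_, _, hy2⟩
      · rw [hx1, Option.some.injEq] at hy1
        exact absurd hy1 (hne' i (by omega))
      all_goals omega
  have := key (3 * n) le_rfl
  omega

/-- The analogue of `ForwardWalk.eq_of_walkMoves_lt` for walks that stop at the node `z`. -/
theorem eq_of_ne_target (hn : 1 < n) {z : ZMod n}
    (hx : ∀ i < 3 * n, x (i + 1) = hop (e i) (x i) (if x i = z then 0 else 1))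
    (hy : ∀ i < 3 * n, y (i + 1) = hop (e i) (y i) (if y i = z then 0 else 1))
    (hxz : x (3 * n) ≠ z) (hyz : y (3 * n) ≠ z) : x (3 * n) = y (3 * n) := by
  have aux : ∀ x : ℕ → ZMod n,
      (∀ i < 3 * n, x (i + 1) = hop (e i) (x i) (if x i = z then 0 else 1)) →
      x (3 * n) ≠ z → (∀ i ≤ 3 * n, x i ≠ z) ∧ ForwardWalk e (3 * n) x := by
    intro x hx hxz
    have h1 : ∀ i ≤ 3 * n, x i ≠ z := by
      intro i hi h
      refine hxz ?_
      have : ∀ j, i ≤ j → j ≤ 3 * n → x j = z := by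
        intro j hij
        induction j, hij using Nat.le_induction with
        | base => exact fun _ => h
        | succ j _ ih =>
          intro hj
          rw [hx j hj, if_pos (ih (by omega)), hop_zero, ih (by omega)]
      exact this _ hi le_rfl
    exact ⟨h1, fun i hi => by rw [hx i hi, if_neg (h1 i hi.le)]⟩
  obtain ⟨x1, x2⟩ := aux x hx hxz
  obtain ⟨_, y2⟩ := aux y hy hyz
  refine x2.eq_of_walkMoves_lt hn y2 ?_
  by_contra h
  obtain ⟨j, hj, hz⟩ := x2.exists_eq hn (not_lt.1 h) z
  exact x1 j hj hz

end Walks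

namespace SmallK

/-! ### Selection phase -/

section Selection

variable {ID : Type} [LinearOrder ID] [Fintype ID] {n k : ℕ} {g : ℕ} {sc : Scenario ID n k}

theorem selection_step [NeZero n] {i : ℕ} (hi : i < 3 * n) {a : Fin k} {m : Memory ID n}
    (hm : mem g sc (2 * i + 1) a = some m) :
    mem g sc (2 * (i + 1)) a = some { m with rounds := bump m.rounds, signed := false } ∧
      node g sc (i + 1) a = hop (sc.missing (2 * i + 1)) (node g sc i a) 1 := by
  have hI : SignedInv g sc i := signedInv (by omega)
  obtain ⟨h1, h2⟩ := hI.mem_succ hm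
  have hr : (m.rounds : ℕ) ≤ 3 * n := by
    rw [(hI.rounds a m hm).1]
    omega
  have : act g (sc.ident a) m (brd g sc (2 * i + 1) (node g sc i a)) =
      next m (brd g sc (2 * i + 1) (node g sc i a)) 1 := by
    simp [act, hr]
  rw [this] at h1 h2
  exact ⟨h1, h2⟩

theorem walkMoves_le (x : ℕ → ZMod n) (i : ℕ) : walkMoves x i ≤ i :=
  (Finset.card_filter_le _ _).trans (Finset.card_range i).le

omit [LinearOrder ID] [Fintype ID] in
/-- A set of IDs of agents is the set of all these IDs if it has at least `k` elements. -/
theorem mem_of_le_card {s : Finset ID} (hs : ∀ x ∈ s, ∃ a, sc.ident a = x) (hk : k ≤ s.card)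
    (a : Fin k) : sc.ident a ∈ s := by
  have h1 : s ⊆ Finset.univ.map sc.ident := by
    intro x hx
    obtain ⟨a, rfl⟩ := hs x hx
    simp
  rw [Finset.eq_of_subset_of_card_le h1 (by simpa using hk)]
  simp

/-- In the selection phase, every agent counts its moves and records the IDs of the agents that
started at the nodes it has visited. -/
theorem selection [NeZero n] {i : ℕ} (hi : i ≤ 3 * n) (a : Fin k) :
    ∃ m, mem g sc (2 * i + 1) a = some m ∧
      (m.nVisited : ℕ) = walkMoves (fun j => node g sc j a) i ∧
      ∀ x, x ∈ m.ids ↔ ∃ b, sc.ident b = x ∧ ∃ j ≤ i, node g sc j a = sc.home b := by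
  induction i with
  | zero =>
    have hI : StartInv g sc 0 := startInv (by omega)
    have h0 : mem g sc (2 * 0) a = some
      { rounds := 1, signed := false, reached := false, nVisited := 0, ids := ∅, dir := 0 } := rfl
    obtain ⟨m, hm, _, _, _, _, h2, _⟩ := hI.mem_signed h0
    obtain ⟨h3, h4⟩ := h2 rfl
    refine ⟨m, hm, by simp [h3], fun x => ?_⟩
    rw [h4]
    simp only [Finset.mem_singleton, Nat.le_zero, exists_eq_left, (hI.first rfl).1,
      sc.home.injective.eq_iff]
    constructor
    · rintro rfl
      exact ⟨a, rfl, rfl⟩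
    · rintro ⟨b, rfl, rfl⟩
      rfl
  | succ i ih =>
    obtain ⟨m, hm, hv, hids⟩ := ih (by omega)
    have hI : StartInv g sc (i + 1) := startInv (by omega)
    obtain ⟨m', hm', _, _, _, _, _, h2, _⟩ := hI.mem_signed (selection_step hi hm).1
    obtain ⟨h3, h4⟩ := h2 (by omega) hi
    simp only [Nat.add_sub_cancel] at h3 h4
    refine ⟨m', hm', ?_, fun x => ?_⟩
    · have := walkMoves_le (fun j => node g sc j a) i
      rw [h3, walkMoves_succ]
      split_ifs
      · simp only [bump, hv]
        omega
      · exact hv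
    · rw [h4]
      have hsucc : (∃ b, sc.ident b = x ∧ ∃ j ≤ i + 1, node g sc j a = sc.home b) ↔
          x ∈ m.ids ∨ ∃ b, sc.home b = node g sc (i + 1) a ∧ sc.ident b = x := by
        rw [hids]
        constructor
        · rintro ⟨b, hb, j, hj, h5⟩
          rcases Nat.le_succ_iff.1 hj with hj | rfl
          · exact Or.inl ⟨b, hb, j, hj, h5⟩
          · exact Or.inr ⟨b, h5.symm, hb⟩
        · rintro (⟨b, hb, j, hj, h5⟩ | ⟨b, h5, hb⟩)
          · exact ⟨b, hb, j, by omega, h5⟩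
          · exact ⟨b, hb, i + 1, le_rfl, h5.symm⟩
      rw [hsucc]
      split_ifs with hc
      · simp only [Finset.mem_union, Option.mem_toFinset, Option.mem_def, hI.id (by omega)]
      · refine ⟨Or.inl, ?_⟩
        rintro (hx | ⟨b, h5, rfl⟩)
        · exact hx
        · by_cases hne : node g sc (i + 1) a = node g sc i a
          · rw [hids]
            exact ⟨b, rfl, i, le_rfl, by rw [h5, hne]⟩
          · refine mem_of_le_card (fun x hx => ?_) (not_lt.1 fun h => hc ⟨hne, h⟩) b
            obtain ⟨b, hb, _⟩ := (hids x).1 hx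
            exact ⟨b, hb⟩

theorem forwardWalk_node [NeZero n] (a : Fin k) :
    ForwardWalk (fun i => sc.missing (2 * i + 1)) (3 * n) (fun i => node g sc i a) := by
  intro i hi
  obtain ⟨m, hm, _⟩ := selection (g := g) (sc := sc) (i := i) hi.le a
  exact (selection_step hi hm).2

/-- At the end of the selection phase, all agents terminate if they are at the same node, and
otherwise they know all IDs and go on. -/
theorem selection_end [NeZero n] (hn : 1 < n) :
    (∃ z, ∀ a, mem g sc (2 * (3 * n + 1)) a = none ∧ node g sc (3 * n + 1) a = z) ∨
    ∀ a, ∃ m, mem g sc (2 * (3 * n) + 1) a = some m ∧ m.ids = Finset.univ.map sc.ident ∧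
      act g (sc.ident a) m (brd g sc (2 * (3 * n) + 1) (node g sc (3 * n) a)) =
        gatherStep m (brd g sc (2 * (3 * n) + 1) (node g sc (3 * n) a)) := by
  have hI : SignedInv g sc (3 * n) := signedInv (by omega)
  have hids : ∀ a m, mem g sc (2 * (3 * n) + 1) a = some m → n ≤ (m.nVisited : ℕ) →
      m.ids = Finset.univ.map sc.ident := by
    intro a m hm hv
    obtain ⟨m', hm', h1, h2⟩ := selection (g := g) (sc := sc) (le_refl (3 * n)) a
    rw [hm] at hm'
    cases hm'
    ext x
    rw [h2]
    simp only [Finset.mem_map, Finset.mem_univ, true_and]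
    refine ⟨fun ⟨b, hb, _⟩ => ⟨b, hb⟩, fun ⟨b, hb⟩ => ⟨b, hb, ?_⟩⟩
    exact (forwardWalk_node a).exists_eq hn (h1 ▸ hv) _
  have hact : ∀ a m w, mem g sc (2 * (3 * n) + 1) a = some m → act g (sc.ident a) m w =
      if (m.nVisited : ℕ) < n then terminate (sc.ident a) w
        else if nAgents m w = m.ids.card then terminate (sc.ident a) w else gatherStep m w := by
    intro a m w hm
    have := (hI.rounds a m hm).1
    simp [act, this]
  by_cases hz : ∃ z, ∀ a, node g sc (3 * n) a = z
  · left
    obtain ⟨z, hz⟩ := hz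
    refine ⟨z, fun a => ?_⟩
    obtain ⟨m, hm, h1, h2⟩ := selection (g := g) (sc := sc) (le_refl (3 * n)) a
    have h3 : act g (sc.ident a) m (brd g sc (2 * (3 * n) + 1) (node g sc (3 * n) a)) =
        terminate (sc.ident a) (brd g sc (2 * (3 * n) + 1) (node g sc (3 * n) a)) := by
      rw [hact a m _ hm]
      split_ifs with h4 h5
      · rfl
      · rfl
      · refine absurd ?_ h5
        rw [hids a m hm (not_lt.1 h4), hI.nAgents_eq _ (hI.rounds a m hm).1, Finset.card_map]
        congr 1
        ext b
        simp [hz]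
    have h4 : mem g sc (2 * (3 * n + 1)) a = none := by
      rw [(hI.mem_succ hm).1, h3]
      rfl
    exact ⟨h4, (hI.node_succ_of_none h4).trans (hz a)⟩
  · right
    intro a
    obtain ⟨m, hm, h1, h2⟩ := selection (g := g) (sc := sc) (le_refl (3 * n)) a
    have hv : ¬ (m.nVisited : ℕ) < n := by
      intro hv
      refine hz ⟨node g sc (3 * n) a, fun b => ?_⟩
      exact ((forwardWalk_node a).eq_of_walkMoves_lt hn (forwardWalk_node b) (h1 ▸ hv)).symm
    have hm_ids := hids a m hm (not_lt.1 hv)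
    refine ⟨m, hm, hm_ids, ?_⟩
    rw [hact a m _ hm, if_neg hv, if_neg]
    rw [hI.nAgents_eq _ (hI.rounds a m hm).1, hm_ids, Finset.card_map]
    intro hc
    have hall := Finset.eq_of_subset_of_card_le (Finset.subset_univ _) hc.ge
    refine hz ⟨node g sc (3 * n) a, fun b => ?_⟩
    have := Finset.mem_univ b
    rwa [← hall, mem_agents] at this

end Selection

/-! ### Moving to the gathering node -/

section Gathering

variable {ID : Type} [LinearOrder ID] [Fintype ID] {n k : ℕ} {g : ℕ} {sc : Scenario ID n k}

/-- At the end of the first part of the gathering phase, the agents that have not reached the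
gathering node are all at one node, unless all agents have terminated at the same node before. -/
theorem gathering [NeZero n] [NeZero k] (hn : 1 < n) :
    (∃ z, ∀ a, mem g sc (2 * (3 * n + 1)) a = none ∧ node g sc (3 * n + 1) a = z) ∨
    (∀ a, ∃ m, mem g sc (2 * (6 * n) + 1) a = some m) ∧
    ∃ z, ∀ a b, node g sc (6 * n) a ≠ z → node g sc (6 * n) b ≠ z →
      node g sc (6 * n) a = node g sc (6 * n) b := by
  refine (selection_end hn).imp_right fun hsel => ?_
  obtain ⟨a₀, -, ha₀⟩ := Finset.exists_min_image (Finset.univ : Finset (Fin k)) sc.ident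
    ⟨0, Finset.mem_univ _⟩
  have hgather : ∀ {i}, i ≤ 6 * n → ∀ (m : Memory ID n) v, m.ids = Finset.univ.map sc.ident →
      (atGatheringNode m (brd g sc (2 * i + 1) v) ↔ v = sc.home a₀) := by
    intro i hi m v hm
    have hI : SignedInv g sc i := signedInv (by omega)
    simp only [atGatheringNode, hm, hI.id, Finset.mem_map, Finset.mem_univ, true_and]
    constructor
    · rintro ⟨_, ⟨b, rfl⟩, ⟨c, hc, hcb⟩, hmin⟩
      rw [sc.ident.injective hcb] at hc
      have : b = a₀ :=
        sc.ident.injective (le_antisymm (hmin _ ⟨a₀, rfl⟩) (ha₀ b (Finset.mem_univ _)))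
      rw [← hc, this]
    · rintro rfl
      refine ⟨_, ⟨a₀, rfl⟩, ⟨a₀, rfl, rfl⟩, ?_⟩
      rintro _ ⟨b, rfl⟩
      exact ha₀ b (Finset.mem_univ _)
  have hact : ∀ {i a m}, 3 * n ≤ i → i < 6 * n → mem g sc (2 * i + 1) a = some m →
      m.ids = Finset.univ.map sc.ident →
      act g (sc.ident a) m (brd g sc (2 * i + 1) (node g sc i a)) =
        gatherStep m (brd g sc (2 * i + 1) (node g sc i a)) := by
    intro i a m h1 h2 hm hids
    have hI : SignedInv g sc i := signedInv (by omega)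
    rcases h1.eq_or_lt with rfl | h1
    · obtain ⟨m', hm', _, h3⟩ := hsel a
      rw [hm] at hm'
      cases hm'
      exact h3
    · have hr := (hI.rounds a m hm).1
      simp only [act, hr]
      rw [if_neg (by omega), if_neg (by omega), if_pos (by omega)]
  have hstep : ∀ {i a m}, 3 * n ≤ i → i < 6 * n → mem g sc (2 * i + 1) a = some m →
      m.ids = Finset.univ.map sc.ident →
      (∃ m', mem g sc (2 * (i + 1) + 1) a = some m' ∧ m'.ids = Finset.univ.map sc.ident) ∧
      node g sc (i + 1) a = hop (sc.missing (2 * i + 1)) (node g sc i a)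
        (if node g sc i a = sc.home a₀ then 0 else 1) := by
    intro i a m h1 h2 hm hids
    have hI : SignedInv g sc i := signedInv (by omega)
    obtain ⟨h3, h4⟩ := hI.mem_succ hm
    rw [hact h1 h2 hm hids] at h3 h4
    constructor
    · have hI' : StartInv g sc (i + 1) := startInv (by omega)
      obtain ⟨m', hm', _, _, _, _, _, _, h5⟩ := hI'.mem_signed h3
      exact ⟨m', hm', ((h5 (by omega)).2).trans hids⟩
    · rw [h4]
      simp only [gatherStep, next, hgather h2.le m _ hids]
  have hall : ∀ i, 3 * n ≤ i → i ≤ 6 * n → ∀ a, ∃ m, mem g sc (2 * i + 1) a = some m ∧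
      m.ids = Finset.univ.map sc.ident := by
    intro i h1
    induction i, h1 using Nat.le_induction with
    | base =>
      intro _ a
      obtain ⟨m, h2, h3, _⟩ := hsel a
      exact ⟨m, h2, h3⟩
    | succ i h1 ih =>
      intro h2 a
      obtain ⟨m, h3, h4⟩ := ih (by omega) a
      exact (hstep h1 h2 h3 h4).1
  refine ⟨fun a => ?_, sc.home a₀, fun a b ha hb => ?_⟩
  · obtain ⟨m, hm, _⟩ := hall (6 * n) (by omega) le_rfl a
    exact ⟨m, hm⟩
  · have hwalk : ∀ a, ∀ i < 3 * n, node g sc (3 * n + (i + 1)) a =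
        hop (sc.missing (2 * (3 * n + i) + 1)) (node g sc (3 * n + i) a)
          (if node g sc (3 * n + i) a = sc.home a₀ then 0 else 1) := by
      intro a i hi
      obtain ⟨m, h1, h2⟩ := hall (3 * n + i) (by omega) (by omega) a
      exact (hstep (by omega) (by omega) h1 h2).2
    have h6 : 6 * n = 3 * n + 3 * n := by ring
    rw [h6] at ha hb ⊢
    exact eq_of_ne_target hn (x := fun i => node g sc (3 * n + i) a)
      (y := fun i => node g sc (3 * n + i) b) (e := fun i => sc.missing (2 * (3 * n + i) + 1))
      (hwalk a) (hwalk b) ha hb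

end Gathering

/-! ### Moving in groups -/

section Groups

variable {ID : Type} [LinearOrder ID] [Fintype ID] {n k : ℕ} {g : ℕ} {sc : Scenario ID n k}

/-- Before the iteration number `i`, the agent `a` has not terminated and belongs to a group of
direction `s`, or to no group if `s = 0`. -/
def Going (g : ℕ) (sc : Scenario ID n k) (i : ℕ) (a : Fin k) (s : SignType) : Prop :=
  ∃ m, mem g sc (2 * i) a = some m ∧ m.dir = s

theorem Going.unique {i : ℕ} {a : Fin k} {s t : SignType} (hs : Going g sc i a s)
    (ht : Going g sc i a t) : s = t := by
  obtain ⟨m, hm, rfl⟩ := hs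
  obtain ⟨m', hm', rfl⟩ := ht
  rw [hm] at hm'
  cases hm'
  rfl

theorem Going.ne_none {i : ℕ} {a : Fin k} {s : SignType} (hs : Going g sc i a s) :
    mem g sc (2 * i) a ≠ none := by
  obtain ⟨m, hm, rfl⟩ := hs
  simp [hm]

theorem none_or_going (g : ℕ) (sc : Scenario ID n k) (i : ℕ) (a : Fin k) :
    mem g sc (2 * i) a = none ∨ ∃ s, Going g sc i a s := by
  rcases hm : mem g sc (2 * i) a with _ | m
  · exact Or.inl rfl
  · exact Or.inr ⟨_, m, hm, rfl⟩

theorem none_succ {i : ℕ} {a : Fin k} (h : mem g sc (2 * i) a = none) :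
    mem g sc (2 * (i + 1)) a = none :=
  (dead_mono h (by omega)).1

theorem node_succ_of_none [NeZero n] {i : ℕ} (hi : i ≤ 7 * n) {a : Fin k}
    (h : mem g sc (2 * (i + 1)) a = none) : node g sc (i + 1) a = node g sc i a :=
  (signedInv hi).node_succ_of_none h

theorem Going.signed [NeZero n] {i : ℕ} (hi : i ≤ 7 * n) {a : Fin k} {s : SignType}
    (h : Going g sc i a s) : ∃ m, mem g sc (2 * i + 1) a = some m ∧ m.dir = s ∧
      (m.rounds : ℕ) = i + 1 ∧ (m.reached = true ↔ node g sc i a ≠ node g sc (i - 1) a) := by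
  obtain ⟨m, hm, rfl⟩ := h
  obtain ⟨m', h1, h2, _, h3, h4, _⟩ := (startInv hi).mem_signed hm
  exact ⟨m', h1, h3, h2, h4⟩

theorem Going.of_succ {i : ℕ} {a : Fin k} {s : SignType}
    (h : Going g sc (i + 1) a s) : ∃ t, Going g sc i a t := by
  rcases none_or_going g sc i a with h0 | h0
  · exact absurd (none_succ h0) h.ne_none
  · exact h0

/-- In this part of the algorithm, an agent that goes on has tried to move in the direction of its
group. -/
theorem Going.node_succ [NeZero n] {i : ℕ} (hi : i ≤ 7 * n) (hi' : 6 * n ≤ i) {a : Fin k}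
    {s : SignType} (h : Going g sc (i + 1) a s) :
    node g sc (i + 1) a = hop (sc.missing (2 * i + 1)) (node g sc i a) s := by
  obtain ⟨t, ht⟩ := h.of_succ
  obtain ⟨m, hm, hd, hr, _⟩ := ht.signed hi
  obtain ⟨m', hm', rfl⟩ := h
  obtain ⟨h1, h2⟩ := (signedInv hi).mem_succ hm
  rw [h2, act_move_eq_dir (by omega) (fun _ => (signedInv hi).early_dir (by omega) a m hm)
    (h1 ▸ hm')]

theorem act_eq_lessStep {m : Memory ID n} (hm : 6 * n + 1 < (m.rounds : ℕ)) (hd : m.dir = 0)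
    (x : ID) (w : Board ID n) : act g x m w = lessStep g x m w := by
  simp only [act]
  rw [if_neg (by omega), if_neg (by omega), if_neg (by omega), if_neg (by omega), if_pos hd]

theorem act_eq_movingStep {m : Memory ID n} (hm : 6 * n + 1 < (m.rounds : ℕ)) (hd : m.dir ≠ 0)
    (x : ID) (w : Board ID n) : act g x m w = movingStep g x m w := by
  simp only [act]
  rw [if_neg (by omega), if_neg (by omega), if_neg (by omega), if_neg (by omega), if_neg hd]

/-- Both marks are at the node `v` when the agents decide in iteration `i`. -/
def BothMarked (g : ℕ) (sc : Scenario ID n k) (i : ℕ) (v : ZMod n) : Prop :=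
  ∀ s ≠ 0, (brd g sc (2 * i + 1) v).Marked s

theorem bothMarked_iff {i : ℕ} {v : ZMod n} : BothMarked g sc i v ↔
    (brd g sc (2 * i + 1) v).fMarked = true ∧ (brd g sc (2 * i + 1) v).bMarked = true := by
  rw [← Board.marked_one, ← Board.marked_neg_one]
  constructor
  · exact fun h => ⟨h 1 (by decide), h (-1) (by decide)⟩
  · rintro ⟨h1, h2⟩ s hs
    rcases SignType.trichotomy s with rfl | rfl | rfl
    · exact h2
    · exact absurd rfl hs
    · exact h1

theorem exists_marked_iff {i : ℕ} {v : ZMod n} : (∃ s, (brd g sc (2 * i + 1) v).Marked s) ↔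
    (brd g sc (2 * i + 1) v).fMarked = true ∨ (brd g sc (2 * i + 1) v).bMarked = true := by
  rw [← Board.marked_one, ← Board.marked_neg_one]
  constructor
  · rintro ⟨s, hs⟩
    rcases SignType.trichotomy s with rfl | rfl | rfl
    · exact Or.inr hs
    · exact absurd rfl hs.ne_zero
    · exact Or.inl hs
  · rintro (h | h)
    · exact ⟨_, h⟩
    · exact ⟨_, h⟩

/-- The agent `a` cannot go on with a joint group at the node `v`, which is too large. -/
def Surplus (g : ℕ) (sc : Scenario ID n k) (i : ℕ) (v : ZMod n) (a : Fin k) : Prop :=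
  2 * g ≤ (agents g sc i v).card ∧ g < rankAt g sc i v a

/-- The decision of a member of a group. -/
theorem Going.moving_succ [NeZero n] {i : ℕ} (hi : i ≤ 7 * n) (hi' : 6 * n < i) {a : Fin k}
    {s : SignType} (h : Going g sc i a s) (hs : s ≠ 0) :
    (mem g sc (2 * (i + 1)) a = none ↔ i = 7 * n ∨ node g sc i a ≠ node g sc (i - 1) a ∧
      (BothMarked g sc i (node g sc i a) ∨
        (brd g sc (2 * i + 1) (node g sc i a)).waiting = true ∧
          Surplus g sc i (node g sc i a) a)) ∧
    (mem g sc (2 * (i + 1)) a ≠ none → Going g sc (i + 1) a s) := by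
  obtain ⟨m, hm, rfl, hr, hre⟩ := h.signed hi
  have hI : SignedInv g sc i := signedInv hi
  have h1 := (hI.mem_succ hm).1
  rw [act_eq_movingStep (by omega) hs] at h1
  simp only [movingStep, hI.nAgents_eq _ hr, hI.rank_eq _ hr, Nat.succ_le_iff] at h1
  rw [← hre, bothMarked_iff]
  unfold Surplus Going
  split_ifs at h1 with c1 c2
  · simp only [terminate] at h1
    simp_all
  · simp only [terminate] at h1
    simp_all
  · rcases groupStep_cases (x := sc.ident a) (m := m)
      (w := brd g sc (2 * i + 1) (node g sc i a)) with ⟨c3, c4⟩ | ⟨c3, c4⟩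
    · rw [c4] at h1
      simp only [next] at h1
      have : i ≠ 7 * n := by omega
      simp only [h1, reduceCtorEq, false_iff, this, false_or, Option.some.injEq, exists_eq_left',
        implies_true, and_true]
      simp only [Bool.and_eq_true, decide_eq_true_eq] at c1 c2
      tauto
    · rw [c4] at h1
      simp only [terminate] at h1
      simp only [h1, true_iff, ne_eq, not_true_eq_false, false_imp_iff, and_true]
      exact Or.inl (by omega)

/-- The decision of a waiting agent. -/
theorem Going.waiting_succ [NeZero n] {i : ℕ} (hi : i ≤ 7 * n) (hi' : 6 * n < i) {a : Fin k}
    (h : Going g sc i a 0) :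
    (mem g sc (2 * (i + 1)) a = none ↔ BothMarked g sc i (node g sc i a) ∨
      (∃ s, (brd g sc (2 * i + 1) (node g sc i a)).Marked s) ∧
        (i = 7 * n ∨ Surplus g sc i (node g sc i a) a)) ∧
    (mem g sc (2 * (i + 1)) a ≠ none →
      (∃ s, (brd g sc (2 * i + 1) (node g sc i a)).Marked s) →
        Going g sc (i + 1) a (brd g sc (2 * i + 1) (node g sc i a)).dir) ∧
    ((¬ ∃ s, (brd g sc (2 * i + 1) (node g sc i a)).Marked s) → Going g sc (i + 1) a 0) := by
  obtain ⟨m, hm, hd, hr, hre⟩ := h.signed hi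
  have hI : SignedInv g sc i := signedInv hi
  have h1 := (hI.mem_succ hm).1
  rw [act_eq_lessStep (by omega) hd] at h1
  simp only [lessStep, hI.nAgents_eq _ hr, hI.rank_eq _ hr, Nat.succ_le_iff] at h1
  rw [bothMarked_iff, exists_marked_iff]
  unfold Surplus Going
  split_ifs at h1 with c1 c2 c3
  · simp only [terminate] at h1
    simp_all
  · simp only [terminate] at h1
    simp only [Bool.and_eq_true, Bool.or_eq_true] at c1 c2
    simp only [h1, c1, c2, c3, ne_eq, not_true_eq_false, false_imp_iff, or_true, and_self]
  · simp only [Bool.and_eq_true, Bool.or_eq_true] at c1 c2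
    rcases groupStep_cases (x := sc.ident a)
      (m := { m with dir := (brd g sc (2 * i + 1) (node g sc i a)).dir })
      (w := brd g sc (2 * i + 1) (node g sc i a)) with ⟨e1, e2⟩ | ⟨e1, e2⟩
    · rw [e2] at h1
      simp only [next] at h1
      have : i ≠ 7 * n := by
        dsimp only at e1
        omega
      simp [h1, c1, c2, c3, this]
    · rw [e2] at h1
      simp only [terminate] at h1
      have : i = 7 * n := by
        dsimp only at e1
        omega
      exact ⟨⟨fun _ => Or.inr ⟨c2, Or.inl this⟩, fun _ => h1⟩, fun hne => absurd h1 hne,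
        fun hne => absurd c2 hne⟩
  · simp only [Bool.and_eq_true, Bool.or_eq_true] at c1 c2
    simp only [next] at h1
    simp [h1, c1, c2, hd]

/-- Two agents that are at the same node and will take the same decisions unless these depend on
the rank: both have terminated, or they belong to the same group and made the same last step. -/
def Twin (g : ℕ) (sc : Scenario ID n k) (i : ℕ) (a b : Fin k) : Prop :=
  node g sc i a = node g sc i b ∧ (mem g sc (2 * i) a = none ∧ mem g sc (2 * i) b = none ∨
    node g sc (i - 1) a = node g sc (i - 1) b ∧ ∃ s, Going g sc i a s ∧ Going g sc i b s)

/-- Agents at the same node that take the same decision become twins. -/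
theorem twin_succ_of [NeZero n] {i : ℕ} (hi : i ≤ 7 * n) (hi' : 6 * n ≤ i) {a b : Fin k}
    (hn : node g sc i a = node g sc i b)
    (h : mem g sc (2 * (i + 1)) a = none ∧ mem g sc (2 * (i + 1)) b = none ∨
      ∃ s, Going g sc (i + 1) a s ∧ Going g sc (i + 1) b s) : Twin g sc (i + 1) a b := by
  rcases h with ⟨h1, h2⟩ | ⟨s, h1, h2⟩
  · exact ⟨by rw [node_succ_of_none hi h1, node_succ_of_none hi h2, hn], Or.inl ⟨h1, h2⟩⟩
  · exact ⟨by rw [h1.node_succ hi hi', h2.node_succ hi hi', hn], Or.inr ⟨hn, s, h1, h2⟩⟩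

/-- Members of a group remain twins in an iteration in which ranks do not matter. -/
theorem Twin.succ [NeZero n] {i : ℕ} (hi : i ≤ 7 * n) (hi' : 6 * n < i) {a b : Fin k}
    (h : Twin g sc i a b) (h0 : ¬ Going g sc i a 0)
    (hw : mem g sc (2 * i) a ≠ none → (brd g sc (2 * i + 1) (node g sc i a)).waiting = true →
      node g sc i a ≠ node g sc (i - 1) a → BothMarked g sc i (node g sc i a)) :
    Twin g sc (i + 1) a b := by
  refine twin_succ_of hi hi'.le h.1 ?_
  rcases h with ⟨hn, ⟨h1, h2⟩ | ⟨hn', s, ha, hb⟩⟩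
  · exact Or.inl ⟨none_succ h1, none_succ h2⟩
  · have hs : s ≠ 0 := by
      rintro rfl
      exact h0 ha
    obtain ⟨a1, a2⟩ := ha.moving_succ hi hi' hs
    obtain ⟨b1, b2⟩ := hb.moving_succ hi hi' hs
    rw [← hn, ← hn'] at b1
    have hw := hw ha.ne_none
    have hab : mem g sc (2 * (i + 1)) a = none ↔ mem g sc (2 * (i + 1)) b = none := by
      rw [a1, b1]
      refine or_congr_right (and_congr_right fun hre => ?_)
      by_cases hB : BothMarked g sc i (node g sc i a)
      · simp only [hB, true_or]
      · have : ¬ (brd g sc (2 * i + 1) (node g sc i a)).waiting = true := fun h => hB (hw h hre)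
        simp only [hB, false_or]
        exact ⟨fun h => absurd h.1 this, fun h => absurd h.1 this⟩
    by_cases hna : mem g sc (2 * (i + 1)) a = none
    · exact Or.inl ⟨hna, hab.1 hna⟩
    · exact Or.inr ⟨s, a2 hna, b2 (mt hab.2 hna)⟩

open Classical in
/-- The agent `a` has at least `g` twins, itself included. -/
def ManyTwins (g : ℕ) (sc : Scenario ID n k) (i : ℕ) (a : Fin k) : Prop :=
  g ≤ (Finset.univ.filter fun b => Twin g sc i a b).card

theorem ManyTwins.of_subset {i : ℕ} {a : Fin k} {S : Finset (Fin k)} (hS : g ≤ S.card)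
    (h : ∀ b ∈ S, Twin g sc i a b) : ManyTwins g sc i a :=
  hS.trans (Finset.card_le_card fun b hb => by simpa using h b hb)

theorem ManyTwins.mono {i j : ℕ} {a : Fin k} (h : ManyTwins g sc i a)
    (hij : ∀ b, Twin g sc i a b → Twin g sc j a b) : ManyTwins g sc j a := by
  classical
  exact .of_subset h fun b hb => hij b (by simpa using hb)

theorem ManyTwins.le_card {i : ℕ} {a : Fin k} (h : ManyTwins g sc i a) :
    g ≤ (agents g sc i (node g sc i a)).card := by
  classical
  refine h.trans (Finset.card_le_card fun b hb => ?_)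
  rw [Finset.mem_filter] at hb
  rw [mem_agents]
  exact hb.2.1.symm

/-- The decision at the gathering node, or at the other node where agents are. -/
theorem first_decision [NeZero n] {a : Fin k}
    (h : ∃ m, mem g sc (2 * (6 * n) + 1) a = some m) {v : ZMod n} (hv : node g sc (6 * n) a = v) :
    ((agents g sc (6 * n) v).card < g → Going g sc (6 * n + 1) a 0) ∧
    (g ≤ (agents g sc (6 * n) v).card → (agents g sc (6 * n) v).card < 2 * g →
      mem g sc (2 * (6 * n + 1)) a = none) ∧
    (2 * g ≤ (agents g sc (6 * n) v).card →
      (rankAt g sc (6 * n) v a ≤ g → Going g sc (6 * n + 1) a 1) ∧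
      (g < rankAt g sc (6 * n) v a →
        (agents g sc (6 * n) v).card < 3 * g ∨ rankAt g sc (6 * n) v a ≤ 2 * g →
        Going g sc (6 * n + 1) a (-1)) ∧
      (2 * g < rankAt g sc (6 * n) v a → 3 * g ≤ (agents g sc (6 * n) v).card →
        mem g sc (2 * (6 * n + 1)) a = none)) := by
  subst hv
  obtain ⟨m, hm⟩ := h
  have hI : SignedInv g sc (6 * n) := signedInv (by omega)
  have hr := (hI.rounds a m hm).1
  have hd := hI.early_dir le_rfl a m hm
  have h1 := (hI.mem_succ hm).1
  have hn := NeZero.pos n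
  have hgs : ∀ s w, (groupStep (sc.ident a) { m with dir := s } w).1 =
      some { m with dir := s, rounds := bump m.rounds, signed := false } := by
    intro s w
    rw [groupStep, if_pos (by dsimp only; omega)]
    rfl
  have hact : act g (sc.ident a) m (brd g sc (2 * (6 * n) + 1) (node g sc (6 * n) a)) =
      if nAgents m (brd g sc (2 * (6 * n) + 1) (node g sc (6 * n) a)) < g then
        next m { brd g sc (2 * (6 * n) + 1) (node g sc (6 * n) a) with waiting := true } 0
      else if nAgents m (brd g sc (2 * (6 * n) + 1) (node g sc (6 * n) a)) < 2 * g then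
        terminate (sc.ident a) (brd g sc (2 * (6 * n) + 1) (node g sc (6 * n) a))
      else more g (sc.ident a) m (brd g sc (2 * (6 * n) + 1) (node g sc (6 * n) a)) := by
    simp only [act]
    rw [if_neg (by omega), if_neg (by omega), if_neg (by omega), if_pos hr]
  rw [hact] at h1
  simp only [more, hI.nAgents_eq _ hr, hI.rank_eq _ hr] at h1
  set N := (agents g sc (6 * n) (node g sc (6 * n) a)).card
  set R := rankAt g sc (6 * n) (node g sc (6 * n) a) a
  refine ⟨fun h2 => ?_, fun h2 h3 => ?_, fun h2 => ⟨fun h3 => ?_, fun h3 h4 => ?_, fun h3 h4 => ?_⟩⟩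
  · rw [if_pos h2] at h1
    exact ⟨_, h1, hd⟩
  · rw [if_neg (by omega), if_pos h3] at h1
    exact h1
  · rw [if_neg (by omega), if_neg (by omega), if_pos h3, hgs] at h1
    exact ⟨_, h1, rfl⟩
  · rw [if_neg (by omega), if_neg (by omega), if_neg (by omega), if_pos h4, hgs] at h1
    exact ⟨_, h1, rfl⟩
  · rw [if_neg (by omega), if_neg (by omega), if_neg (by omega), if_neg (by omega)] at h1
    exact h1

theorem card_lt_rankAt (i : ℕ) (v : ZMod n) (j : ℕ) :
    ((agents g sc i v).filter fun a => j < rankAt g sc i v a).card + min j (agents g sc i v).card =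
      (agents g sc i v).card := by
  rw [← card_rankAt_le, add_comm]
  simp only [← not_le]
  exact Finset.card_filter_add_card_filter_not _

theorem card_rankAt_mem_Ioc (i : ℕ) (v : ZMod n) {j l : ℕ} (hjl : j ≤ l)
    (hl : l ≤ (agents g sc i v).card) :
    ((agents g sc i v).filter fun a => j < rankAt g sc i v a ∧ rankAt g sc i v a ≤ l).card =
      l - j := by
  have h1 := Finset.card_filter_add_card_filter_not (fun a => rankAt g sc i v a ≤ j)
    (s := (agents g sc i v).filter fun a => rankAt g sc i v a ≤ l)
  rw [Finset.filter_filter, Finset.filter_filter, card_rankAt_le, min_eq_left hl] at h1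
  have h2 : ((agents g sc i v).filter fun a => rankAt g sc i v a ≤ l ∧ rankAt g sc i v a ≤ j) =
      (agents g sc i v).filter fun a => rankAt g sc i v a ≤ j :=
    Finset.filter_congr fun a _ => ⟨fun h => h.2, fun h => ⟨h.trans hjl, h⟩⟩
  have h3 : ((agents g sc i v).filter fun a => rankAt g sc i v a ≤ l ∧ ¬ rankAt g sc i v a ≤ j) =
      (agents g sc i v).filter fun a => j < rankAt g sc i v a ∧ rankAt g sc i v a ≤ l :=
    Finset.filter_congr fun a _ => by rw [not_le, and_comm]
  rw [h2, h3, card_rankAt_le, min_eq_left (hjl.trans hl)] at h1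
  omega

/-- At a node with at least `g` agents, these are divided into classes of at least `g` twins. -/
theorem manyTwins_first [NeZero n] (h : ∀ a, ∃ m, mem g sc (2 * (6 * n) + 1) a = some m)
    {a : Fin k} (ha : g ≤ (agents g sc (6 * n) (node g sc (6 * n) a)).card) :
    ManyTwins g sc (6 * n + 1) a := by
  generalize hv : node g sc (6 * n) a = v at ha
  obtain ⟨_, a2, a3⟩ := first_decision (h a) hv
  by_cases h2 : (agents g sc (6 * n) v).card < 2 * g
  · refine .of_subset ha fun b hb => ?_
    rw [mem_agents] at hb
    obtain ⟨_, b2, b3⟩ := first_decision (h b) hb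
    exact twin_succ_of (by omega) le_rfl (hv.trans hb.symm) (Or.inl ⟨a2 ha h2, b2 ha h2⟩)
  · rw [not_lt] at h2
    obtain ⟨a3, a4, a5⟩ := a3 h2
    by_cases h3 : rankAt g sc (6 * n) v a ≤ g
    · refine .of_subset (S := (agents g sc (6 * n) v).filter fun b => rankAt g sc (6 * n) v b ≤ g)
        ?_ fun b hb => ?_
      · rw [card_rankAt_le]
        omega
      · rw [Finset.mem_filter, mem_agents] at hb
        obtain ⟨b3, _⟩ := (first_decision (h b) hb.1).2.2 h2
        exact twin_succ_of (by omega) le_rfl (hv.trans hb.1.symm) (Or.inr ⟨1, a3 h3, b3 hb.2⟩)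
    rw [not_le] at h3
    by_cases h4 : (agents g sc (6 * n) v).card < 3 * g
    · refine .of_subset (S := (agents g sc (6 * n) v).filter fun b => g < rankAt g sc (6 * n) v b)
        ?_ fun b hb => ?_
      · have := card_lt_rankAt (g := g) (sc := sc) (6 * n) v g
        omega
      · rw [Finset.mem_filter, mem_agents] at hb
        obtain ⟨_, b4, _⟩ := (first_decision (h b) hb.1).2.2 h2
        exact twin_succ_of (by omega) le_rfl (hv.trans hb.1.symm)
          (Or.inr ⟨-1, a4 h3 (Or.inl h4), b4 hb.2 (Or.inl h4)⟩)
    rw [not_lt] at h4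
    by_cases h5 : rankAt g sc (6 * n) v a ≤ 2 * g
    · refine .of_subset (S := (agents g sc (6 * n) v).filter fun b =>
        g < rankAt g sc (6 * n) v b ∧ rankAt g sc (6 * n) v b ≤ 2 * g) ?_ fun b hb => ?_
      · rw [card_rankAt_mem_Ioc _ _ (by omega) h2]
        omega
      · rw [Finset.mem_filter, mem_agents] at hb
        obtain ⟨_, b4, _⟩ := (first_decision (h b) hb.1).2.2 h2
        exact twin_succ_of (by omega) le_rfl (hv.trans hb.1.symm)
          (Or.inr ⟨-1, a4 h3 (Or.inr h5), b4 hb.2.1 (Or.inr hb.2.2)⟩)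
    · rw [not_le] at h5
      refine .of_subset
        (S := (agents g sc (6 * n) v).filter fun b => 2 * g < rankAt g sc (6 * n) v b)
        ?_ fun b hb => ?_
      · have := card_lt_rankAt (g := g) (sc := sc) (6 * n) v (2 * g)
        omega
      · rw [Finset.mem_filter, mem_agents] at hb
        obtain ⟨_, _, b5⟩ := (first_decision (h b) hb.1).2.2 h2
        exact twin_succ_of (by omega) le_rfl (hv.trans hb.1.symm)
          (Or.inl ⟨a5 h5 h4, b5 hb.2 h4⟩)

/-- The nodes with fewer than `g` agents at the beginning of the movement in groups remain the nodes
where a group can be joined. -/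
theorem waiting_iff [NeZero n] (h : ∀ a, ∃ m, mem g sc (2 * (6 * n) + 1) a = some m)
    {i : ℕ} (hi : i ≤ 7 * n) (hi' : 6 * n < i) (v : ZMod n) :
    (brd g sc (2 * i + 1) v).waiting = true ↔
      (agents g sc (6 * n) v).card < g ∧ ∃ a, node g sc (6 * n) a = v := by
  rw [(startInv hi).signSpec.waiting]
  induction i, hi' using Nat.le_induction with
  | base =>
    have hI : SignedInv g sc (6 * n) := signedInv (by omega)
    have h2 := hI.actSpec.waiting v
    rw [(hI.early le_rfl v).1] at h2
    rw [h2]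
    constructor
    · rintro (h3 | ⟨a, m, _, rfl, _, h3⟩)
      · cases h3
      · exact ⟨h3, a, rfl⟩
    · rintro ⟨h3, a, rfl⟩
      obtain ⟨m, hm⟩ := h a
      exact Or.inr ⟨a, m, hm, rfl, rfl, h3⟩
  | succ i hi' ih =>
    have hI : StartInv g sc i := startInv (by omega)
    rw [← ih (by omega), hI.signedInv.actSpec.waiting, hI.signSpec.waiting]
    refine ⟨?_, Or.inl⟩
    rintro (h3 | ⟨_, _, _, _, h3, _⟩)
    · exact h3
    · omega

/-- The result of the algorithm: all agents have terminated, at nodes with at least `g` agents. -/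
def Gathered (g : ℕ) (sc : Scenario ID n k) (i : ℕ) : Prop :=
  ∀ a, mem g sc (2 * i) a = none ∧ g ≤ (agents g sc i (node g sc i a)).card

theorem gathered_of_last [NeZero n] (h0 : ∀ a, mem g sc (2 * (7 * n + 1)) a = none)
    (h : ∀ a, g ≤ (agents g sc (7 * n) (node g sc (7 * n) a)).card) :
    Gathered g sc (7 * n + 1) := by
  refine fun a => ⟨h0 a, (h a).trans (Finset.card_le_card fun b hb => ?_)⟩
  rw [mem_agents] at hb ⊢
  rw [node_succ_of_none le_rfl (h0 a), node_succ_of_none le_rfl (h0 b), hb]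

/-- If no agents wait, then all groups stay together. -/
theorem gathered_of_no_waiting [NeZero n] (h : ∀ a, ∃ m, mem g sc (2 * (6 * n) + 1) a = some m)
    (hg : ∀ a, g ≤ (agents g sc (6 * n) (node g sc (6 * n) a)).card) :
    Gathered g sc (7 * n + 1) := by
  have hw : ∀ {i}, i ≤ 7 * n → 6 * n < i → ∀ v, ¬ (brd g sc (2 * i + 1) v).waiting = true := by
    intro i hi hi' v
    rw [waiting_iff h hi hi']
    rintro ⟨h1, a, rfl⟩
    exact h1.not_ge (hg a)
  have key : ∀ i, 6 * n < i → i ≤ 7 * n →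
      ∀ a, ¬ Going g sc i a 0 ∧ ManyTwins g sc i a := by
    intro i hi'
    induction i, hi' using Nat.le_induction with
    | base =>
      refine fun _ a => ⟨fun h0 => ?_, manyTwins_first h (hg a)⟩
      obtain ⟨_, a2, a3⟩ := first_decision (h a) rfl
      have h1 := hg a
      by_cases h2 : (agents g sc (6 * n) (node g sc (6 * n) a)).card < 2 * g
      · exact h0.ne_none (a2 h1 h2)
      · obtain ⟨a3, a4, a5⟩ := a3 (not_lt.1 h2)
        rcases le_or_gt (rankAt g sc (6 * n) (node g sc (6 * n) a) a) g with h3 | h3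
        · exact absurd ((a3 h3).unique h0) (by decide)
        · by_cases h4 : (agents g sc (6 * n) (node g sc (6 * n) a)).card < 3 * g ∨
              rankAt g sc (6 * n) (node g sc (6 * n) a) a ≤ 2 * g
          · exact absurd ((a4 h3 h4).unique h0) (by decide)
          · exact h0.ne_none (a5 (by omega) (by omega))
    | succ i hi' ih =>
      intro hi a
      obtain ⟨h1, h2⟩ := ih (by omega) a
      refine ⟨fun h0 => ?_, h2.mono fun b hb => hb.succ (by omega) (by omega) h1
        fun _ h3 => absurd h3 (hw (by omega) (by omega) _)⟩
      obtain ⟨s, hs⟩ := h0.of_succ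
      have hs0 : s ≠ 0 := by
        rintro rfl
        exact h1 hs
      exact hs0 (((hs.moving_succ (by omega) (by omega) hs0).2 h0.ne_none).unique h0)
  have hn := NeZero.pos n
  refine gathered_of_last (fun a => ?_) fun a => (key (7 * n) (by omega) le_rfl a).2.le_card
  rcases none_or_going g sc (7 * n) a with h0 | ⟨s, hs⟩
  · exact none_succ h0
  · have hs0 : s ≠ 0 := by
      rintro rfl
      exact (key (7 * n) (by omega) le_rfl a).1 hs
    exact (hs.moving_succ le_rfl (by omega) hs0).1.2 (Or.inl rfl)

end Groups

end SmallK

/-! ### Two groups leaving a node in opposite directions -/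

section Rays

variable {n : ℕ}

theorem signType_eq_or_eq_neg {s t : SignType} (hs : s ≠ 0) (ht : t ≠ 0) : t = s ∨ t = -s := by
  revert s t
  decide

/-- The node that is reached from `u` by `j` moves in the direction `s`. -/
def ray (u : ZMod n) (s : SignType) (j : ℕ) : ZMod n := u + (s : ZMod n) * j

@[simp] theorem ray_zero (u : ZMod n) (s : SignType) : ray u s 0 = u := by simp [ray]

theorem ray_eq_ray_iff (u : ZMod n) {s : SignType} (hs : s ≠ 0) (i j : ℕ) :
    ray u s i = ray u s j ↔ (i : ZMod n) = j := by
  unfold ray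
  rcases SignType.trichotomy s with rfl | rfl | rfl
  · simp
  · exact absurd rfl hs
  · simp

theorem ray_eq_ray_neg_iff (u : ZMod n) {s : SignType} (hs : s ≠ 0) (i j : ℕ) :
    ray u s i = ray u (-s) j ↔ n ∣ i + j := by
  rw [← ZMod.natCast_eq_zero_iff]
  unfold ray
  push_cast
  rcases SignType.trichotomy s with rfl | rfl | rfl
  · simp only [SignType.coe_neg_one, neg_neg]
    constructor <;> intro h <;> linear_combination -h
  · exact absurd rfl hs
  · simp only [SignType.coe_one]
    constructor <;> intro h <;> linear_combination h

/-- A ray of length at most `n` comes only once to a node different from its origin. -/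
theorem ray_eq_ray_iff_of_le (u : ZMod n) {s : SignType} (hs : s ≠ 0) {i d : ℕ} (h0 : 0 < d)
    (hd : d < n) (hi : i ≤ n) : ray u s d = ray u s i ↔ d = i := by
  rw [ray_eq_ray_iff u hs, ZMod.natCast_eq_natCast_iff']
  rcases hi.eq_or_lt with rfl | hi
  · rw [Nat.mod_self, Nat.mod_eq_of_lt hd]
    omega
  · rw [Nat.mod_eq_of_lt hd, Nat.mod_eq_of_lt hi]

theorem ray_succ_ne (hn : 1 < n) (u : ZMod n) {s : SignType} (hs : s ≠ 0) (j : ℕ) :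
    ray u s (j + 1) ≠ ray u s j := by
  rw [ne_eq, ray_eq_ray_iff u hs]
  push_cast
  exact add_one_ne_self hn _

theorem hop_ray (e : Option (ZMod n)) (u : ZMod n) {s : SignType} (hs : s ≠ 0) (j : ℕ) :
    hop e (ray u s j) s = ray u s j ∨ hop e (ray u s j) s = ray u s (j + 1) := by
  rcases SignType.trichotomy s with rfl | rfl | rfl
  · rw [hop_neg_one]
    split_ifs
    · exact Or.inl rfl
    · right
      simp only [ray, SignType.coe_neg_one]
      push_cast
      ring
  · exact absurd rfl hs
  · rw [hop_one]
    split_ifs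
    · exact Or.inl rfl
    · right
      simp only [ray, SignType.coe_one]
      push_cast
      ring

/-- Two groups that have left a node in opposite directions cannot both be blocked unless they have
met, because they try to cross different links. -/
theorem hop_ray_ne_or (hn : 1 < n) (e : Option (ZMod n)) (u : ZMod n) {i j : ℕ}
    (h : i + j + 2 ≤ n) :
    hop e (ray u 1 i) 1 = ray u 1 (i + 1) ∨ hop e (ray u (-1) j) (-1) = ray u (-1) (j + 1) := by
  by_contra! hc
  have h1 := (hop_ray e u (s := 1) (by decide) i).resolve_right hc.1
  have h2 := (hop_ray e u (s := -1) (by decide) j).resolve_right hc.2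
  have : Fact (1 < n) := ⟨hn⟩
  rw [hop_one] at h1
  rw [hop_neg_one] at h2
  split_ifs at h1 with e1
  · split_ifs at h2 with e2
    · rw [e1, Option.some.injEq] at e2
      have h3 : ray u 1 (i + 1) = ray u (-1) j := by
        have : ray u 1 (i + 1) = ray u 1 i + 1 := by
          simp only [ray, SignType.coe_one]
          push_cast
          ring
        rw [this, e2]
        ring
      rw [ray_eq_ray_neg_iff u (by decide)] at h3
      have := Nat.le_of_dvd (by omega) h3
      omega
    · simp at h2
  · simp at h1

end Rays

namespace SmallK

section TwoGroups

variable {ID : Type} [LinearOrder ID] [Fintype ID] {n k : ℕ} {g : ℕ} {sc : Scenario ID n k}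

/-- One step of the groups of direction `s`, when all their members are on the ray from `u` in the
direction `s`, after `p s` moves. -/
theorem exists_next_moves [NeZero n] (hn : 1 < n) {i : ℕ} (hi : i ≤ 7 * n) (hi' : 6 * n ≤ i)
    {u : ZMod n} {p : SignType → ℕ}
    (h : ∀ a s, s ≠ 0 → Going g sc (i + 1) a s → node g sc i a = ray u s (p s)) :
    ∃ p' : SignType → ℕ,
      (∀ a s, s ≠ 0 → Going g sc (i + 1) a s → node g sc (i + 1) a = ray u s (p' s)) ∧
      (∀ s, p s ≤ p' s ∧ p' s ≤ p s + 1) ∧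
      (∀ s, p s < p' s → ∃ a, Going g sc (i + 1) a s) ∧
      (p 1 + p (-1) + 2 ≤ n → (∃ a, Going g sc (i + 1) a 1) → (∃ a, Going g sc (i + 1) a (-1)) →
        p 1 + p (-1) + 1 ≤ p' 1 + p' (-1)) := by
  classical
  refine ⟨fun s => if (∃ a, Going g sc (i + 1) a s) ∧
    hop (sc.missing (2 * i + 1)) (ray u s (p s)) s = ray u s (p s + 1) then p s + 1 else p s,
    fun a s hs ha => ?_, fun s => ?_, fun s hs => ?_, fun hp h1 h2 => ?_⟩
  · rw [ha.node_succ hi hi', h a s hs ha]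
    dsimp only
    split_ifs with hc
    · exact hc.2
    · exact (hop_ray _ u hs _).resolve_right fun h => hc ⟨⟨a, ha⟩, h⟩
  · dsimp only
    split_ifs <;> omega
  · by_contra hc
    simp [hc] at hs
  · have := hop_ray_ne_or hn (sc.missing (2 * i + 1)) u hp
    simp only [h1, h2, true_and]
    split_ifs <;> first | omega | tauto

/-- The configuration before the iteration number `i`, when one group has left the node `u` in each
direction, and agents wait at the node at distance `d s` from `u` in direction `s`. Here `p s`
is the number of moves of the group of direction `s`, and `p₀ s` this number one iteration before,
which is what the marks show. -/
structure GroupInv (g : ℕ) (sc : Scenario ID n k) (u W : ZMod n) (d : SignType → ℕ)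
    (i : ℕ) (p₀ p : SignType → ℕ) : Prop where
  before : ∀ a s, s ≠ 0 → Going g sc i a s → node g sc (i - 1) a = ray u s (p₀ s)
  now : ∀ a s, s ≠ 0 → Going g sc i a s → node g sc i a = ray u s (p s)
  marked : ∀ v s, s ≠ 0 → ((brd g sc (2 * i) v).Marked s ↔ ∃ j ≤ p₀ s, v = ray u s j)
  le : ∀ s, p₀ s ≤ p s ∧ p s ≤ p₀ s + 1
  bound : ∀ s, 6 * n + p s ≤ i
  moved : ∀ s, p₀ s < p s → ∃ a, Going g sc i a s
  progress : n ≤ p 1 + p (-1) + 1 ∨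
    i ≤ 6 * n + p 1 + p (-1) ∧ (∃ a, Going g sc i a 1) ∧ ∃ a, Going g sc i a (-1)
  waiting : ∀ a, Going g sc i a 0 → node g sc i a = W ∧ ∀ s ≠ 0, p₀ s < d s
  fresh : (∀ s ≠ 0, p₀ s < d s) → ∀ a, node g sc i a = W → mem g sc (2 * i) a ≠ none
  twins : ∀ a, Going g sc i a 0 ∨ ManyTwins g sc i a

/-- The node `W ≠ u` is at distance `d s` from `u` in the direction `s`. -/
structure IsDist (u W : ZMod n) (d : SignType → ℕ) : Prop where
  pos : ∀ s ≠ 0, 0 < d s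
  eq : ∀ s ≠ 0, W = ray u s (d s)
  add : ∀ s ≠ 0, d s + d (-s) = n

theorem IsDist.lt {u W : ZMod n} {d : SignType → ℕ} (h : IsDist u W d) {s : SignType}
    (hs : s ≠ 0) : d s < n := by
  have h1 := h.add s hs
  have h2 := h.pos (-s) (by simpa using hs)
  omega

theorem exists_isDist [NeZero n] {u W : ZMod n} (h : W ≠ u) : ∃ d, IsDist u W d := by
  have h0 : 0 < (W - u).val := by
    rw [Nat.pos_iff_ne_zero, ne_eq, ZMod.val_eq_zero, sub_eq_zero]
    exact h
  have h1 := ZMod.val_lt (W - u)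
  refine ⟨fun s => if s = 1 then (W - u).val else n - (W - u).val, ?_, ?_, ?_⟩ <;>
    intro s hs <;> rcases SignType.trichotomy s with rfl | rfl | rfl <;>
    first | exact absurd rfl hs | skip
  · simpa [show (-1 : SignType) ≠ 1 by decide] using h1
  · simpa using h0
  · simp [show (-1 : SignType) ≠ 1 by decide, ray, Nat.cast_sub h1.le]
  · simp [ray]
  · simp [show (-1 : SignType) ≠ 1 by decide]
    omega
  · simp [show (-1 : SignType) ≠ 1 by decide]
    omega

section Step

variable [NeZero n] {u W : ZMod n} {d : SignType → ℕ} {i : ℕ} {p₀ p : SignType → ℕ}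

/-- The marks after the first round of an iteration show the current positions of the groups. -/
theorem GroupInv.marked_signed (h : GroupInv g sc u W d i p₀ p) (hn : 1 < n) (hi : i ≤ 7 * n)
    (hi' : 6 * n < i) {s : SignType} (hs : s ≠ 0) (v : ZMod n) :
    (brd g sc (2 * i + 1) v).Marked s ↔ ∃ j ≤ p s, v = ray u s j := by
  rw [(startInv hi).signSpec.marked, h.marked v s hs]
  obtain ⟨h1, h2⟩ := h.le s
  constructor
  · rintro (⟨j, hj, hv⟩ | ⟨_, a, m, hm, rfl, _, hd, _⟩)
    · exact ⟨j, hj.trans h1, hv⟩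
    · exact ⟨p s, le_rfl, h.now a s hs ⟨m, hm, hd⟩⟩
  · rintro ⟨j, hj, rfl⟩
    by_cases hj' : j ≤ p₀ s
    · exact Or.inl ⟨j, hj', rfl⟩
    · obtain rfl : j = p s := by omega
      obtain ⟨a, ha⟩ := h.moved s (by omega)
      obtain ⟨m, hm, hd⟩ := id ha
      refine Or.inr ⟨hi', a, m, hm, h.now a s hs ha, ?_, hd, hs⟩
      rw [h.now a s hs ha, h.before a s hs ha, show p s = p₀ s + 1 by omega]
      exact ray_succ_ne hn u hs _

omit [NeZero n] in
theorem GroupInv.le_n (h : GroupInv g sc u W d i p₀ p) (hi : i ≤ 7 * n) (s : SignType) :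
    p s ≤ n := by
  have := h.bound s
  omega

omit [NeZero n] in
theorem exists_ray_iff (hd : IsDist u W d) {s : SignType} (hs : s ≠ 0) {j : ℕ} (hj : j ≤ n) :
    (∃ l ≤ j, W = ray u s l) ↔ d s ≤ j := by
  rw [hd.eq s hs]
  constructor
  · rintro ⟨l, hl, h⟩
    rw [ray_eq_ray_iff_of_le u hs (hd.pos s hs) (hd.lt hs) (hl.trans hj)] at h
    omega
  · exact fun h => ⟨d s, h, rfl⟩

omit [NeZero n] in
theorem GroupInv.marked_iff (h : GroupInv g sc u W d i p₀ p) (hd : IsDist u W d) (hi : i ≤ 7 * n)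
    {s : SignType} (hs : s ≠ 0) : (brd g sc (2 * i) W).Marked s ↔ d s ≤ p₀ s := by
  rw [h.marked W s hs, exists_ray_iff hd hs ((h.le s).1.trans (h.le_n hi s))]

theorem GroupInv.marked_signed_iff (h : GroupInv g sc u W d i p₀ p) (hd : IsDist u W d)
    (hn : 1 < n) (hi : i ≤ 7 * n) (hi' : 6 * n < i) {s : SignType} (hs : s ≠ 0) :
    (brd g sc (2 * i + 1) W).Marked s ↔ d s ≤ p s := by
  rw [h.marked_signed hn hi hi' hs W, exists_ray_iff hd hs (h.le_n hi s)]

theorem GroupInv.exists_marked_iff (h : GroupInv g sc u W d i p₀ p) (hd : IsDist u W d)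
    (hn : 1 < n) (hi : i ≤ 7 * n) (hi' : 6 * n < i) :
    (∃ s, (brd g sc (2 * i + 1) W).Marked s) ↔ ∃ s ≠ 0, d s ≤ p s := by
  constructor
  · rintro ⟨s, hs⟩
    exact ⟨s, hs.ne_zero, (h.marked_signed_iff hd hn hi hi' hs.ne_zero).1 hs⟩
  · rintro ⟨s, hs, h1⟩
    exact ⟨s, (h.marked_signed_iff hd hn hi hi' hs).2 h1⟩

/-- Two groups have not met if they have visited fewer than `n` nodes. -/
theorem GroupInv.not_bothMarked (h : GroupInv g sc u W d i p₀ p) (hn : 1 < n) (hi : i ≤ 7 * n)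
    (hi' : 6 * n < i) (hp : p 1 + p (-1) + 2 ≤ n) {s : SignType} (hs : s ≠ 0) (h0 : 0 < p s) :
    ¬ BothMarked g sc i (ray u s (p s)) := by
  intro hB
  have hs' : -s ≠ 0 := by simpa using hs
  obtain ⟨j, hj, h1⟩ := (h.marked_signed hn hi hi' hs' _).1 (hB (-s) hs')
  rw [ray_eq_ray_neg_iff u hs] at h1
  have h2 := Nat.le_of_dvd (by omega) h1
  have h3 : p s + p (-s) = p 1 + p (-1) := by
    rcases SignType.trichotomy s with rfl | rfl | rfl
    · rw [neg_neg, add_comm]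
    · exact absurd rfl hs
    · rfl
  omega

/-- If agents are waiting and a group arrives, then there are at least `g` agents at the node. -/
theorem GroupInv.le_card_of_arrival (h : GroupInv g sc u W d i p₀ p) (hd : IsDist u W d)
    (hn : 1 < n) (hi : i ≤ 7 * n) (hi' : 6 * n < i) (hW : ∀ s ≠ 0, p₀ s < d s) {s : SignType}
    (hs : s ≠ 0) (hm : d s ≤ p s) : g ≤ (agents g sc i W).card := by
  have h1 := (h.marked_signed_iff hd hn hi hi' hs).2 hm
  rw [(startInv hi).signSpec.marked, h.marked_iff hd hi hs] at h1
  rcases h1 with h1 | ⟨_, a, m, h2, h3, _, h4, _⟩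
  · exact absurd h1 (not_le.2 (hW s hs))
  · rw [← h3]
    refine ((h.twins a).resolve_left fun h0 => hs ?_).le_card
    exact (h0.unique ⟨m, h2, h4⟩).symm

/-- The decisions at the node of waiting agents when a group arrives. -/
theorem GroupInv.arrival (h : GroupInv g sc u W d i p₀ p) (hd : IsDist u W d)
    (hw : ∀ v, (brd g sc (2 * i + 1) v).waiting = true ↔ v = W)
    (hn : 1 < n) (hi : i < 7 * n) (hi' : 6 * n < i) (hW : ∀ s ≠ 0, p₀ s < d s) {s : SignType}
    (hs : s ≠ 0) (hm : d s ≤ p s) {a : Fin k} (ha : node g sc i a = W) :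
    (d (-s) ≤ p (-s) → mem g sc (2 * (i + 1)) a = none) ∧
    (p (-s) < d (-s) → (mem g sc (2 * (i + 1)) a = none ↔ Surplus g sc i W a) ∧
      (mem g sc (2 * (i + 1)) a ≠ none → Going g sc (i + 1) a s)) := by
  have hs' : -s ≠ 0 := by simpa using hs
  have hms := (h.marked_signed_iff hd hn hi.le hi' hs).2 hm
  have hB : BothMarked g sc i W ↔ d (-s) ≤ p (-s) := by
    rw [← h.marked_signed_iff hd hn hi.le hi' hs']
    refine ⟨fun h => h _ hs', fun h t ht => ?_⟩
    rcases signType_eq_or_eq_neg hs ht with rfl | rfl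
    · exact hms
    · exact h
  have hone : p (-s) < d (-s) → ∀ t, (brd g sc (2 * i + 1) W).Marked t → t = s := by
    intro hlt t ht
    have ht0 := ht.ne_zero
    by_contra hts
    have : t = -s := (signType_eq_or_eq_neg hs ht0).resolve_left hts
    rw [h.marked_signed_iff hd hn hi.le hi' ht0, this] at ht
    omega
  rcases none_or_going g sc i a with h0 | ⟨t, ht⟩
  · exact absurd h0 (h.fresh hW a ha)
  by_cases ht0 : t = 0
  · subst ht0
    obtain ⟨w1, w2, _⟩ := ht.waiting_succ hi.le hi'
    rw [ha] at w1 w2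
    constructor
    · exact fun hlt => w1.2 (Or.inl (hB.2 hlt))
    · intro hlt
      have hnB : ¬ BothMarked g sc i W := fun hb => absurd (hB.1 hb) (not_le.2 hlt)
      have hI : SignedInv g sc i := signedInv hi.le
      have hdir : (brd g sc (2 * i + 1) W).dir = s :=
        hone hlt _ (hI.dir_marked W (hI.waiting_dir W s ((hw W).2 rfl) hms))
      rw [hdir] at w2
      refine ⟨?_, fun h1 => w2 h1 ⟨s, hms⟩⟩
      rw [w1]
      constructor
      · rintro (h1 | ⟨_, h1 | h1⟩)
        · exact absurd h1 hnB
        · omega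
        · exact h1
      · exact fun h1 => Or.inr ⟨⟨s, hms⟩, Or.inr h1⟩
  · obtain ⟨w1, w2⟩ := ht.moving_succ hi.le hi' ht0
    have hreach : node g sc i a ≠ node g sc (i - 1) a := by
      obtain ⟨m, hm, hmd⟩ := id ht
      rcases (startInv hi.le).moves hi' a m hm (by rwa [hmd]) with h1 | h1
      · rw [ha, hmd, h.marked_iff hd hi.le ht0] at h1
        exact absurd h1 (not_le.2 (hW t ht0))
      · exact h1
    rw [ha] at w1
    rw [ha] at hreach
    constructor
    · exact fun hlt => w1.2 (Or.inr ⟨hreach, Or.inl (hB.2 hlt)⟩)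
    · intro hlt
      have hnB : ¬ BothMarked g sc i W := fun hb => absurd (hB.1 hb) (not_le.2 hlt)
      obtain ⟨m, hm, hmd, _⟩ := ht.signed hi.le
      have hts : t = s := by
        have := (signedInv hi.le).marked a m hm (by rwa [hmd])
        rw [ha, hmd] at this
        exact hone hlt t this
      subst hts
      refine ⟨?_, w2⟩
      rw [w1]
      constructor
      · rintro (h1 | ⟨_, h1 | h1⟩)
        · omega
        · exact absurd h1 hnB
        · exact h1.2
      · exact fun h1 => Or.inr ⟨hreach, Or.inr ⟨(hw W).2 rfl, h1⟩⟩

/-- Where a group arrives at waiting agents, the agents are divided into classes of at least `g`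
twins. -/
theorem GroupInv.manyTwins_arrival (h : GroupInv g sc u W d i p₀ p) (hd : IsDist u W d)
    (hw : ∀ v, (brd g sc (2 * i + 1) v).waiting = true ↔ v = W)
    (hn : 1 < n) (hi : i < 7 * n) (hi' : 6 * n < i) (hW : ∀ s ≠ 0, p₀ s < d s) {s : SignType}
    (hs : s ≠ 0) (hm : d s ≤ p s) {a : Fin k} (ha : node g sc i a = W) :
    ManyTwins g sc (i + 1) a := by
  have hcard := h.le_card_of_arrival hd hn hi.le hi' hW hs hm
  have harr : ∀ {b}, node g sc i b = W → _ := fun {b} hb => h.arrival hd hw hn hi hi' hW hs hm hb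
  obtain ⟨a1, a2⟩ := harr ha
  by_cases hlt : d (-s) ≤ p (-s)
  · refine .of_subset hcard fun b hb => ?_
    rw [mem_agents] at hb
    exact twin_succ_of hi.le hi'.le (ha.trans hb.symm) (Or.inl ⟨a1 hlt, (harr hb).1 hlt⟩)
  · rw [not_le] at hlt
    obtain ⟨a2, a3⟩ := a2 hlt
    by_cases h2 : 2 * g ≤ (agents g sc i W).card
    · by_cases h3 : rankAt g sc i W a ≤ g
      · refine .of_subset (S := (agents g sc i W).filter fun b => rankAt g sc i W b ≤ g)
          ?_ fun b hb => ?_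
        · rw [card_rankAt_le]
          omega
        · rw [Finset.mem_filter, mem_agents] at hb
          obtain ⟨b2, b3⟩ := (harr hb.1).2 hlt
          exact twin_succ_of hi.le hi'.le (ha.trans hb.1.symm)
            (Or.inr ⟨s, a3 (mt a2.1 fun h => h.2.not_ge h3),
              b3 (mt b2.1 fun h => h.2.not_ge hb.2)⟩)
      · refine .of_subset (S := (agents g sc i W).filter fun b => g < rankAt g sc i W b)
          ?_ fun b hb => ?_
        · have := card_lt_rankAt (g := g) (sc := sc) i W g
          omega
        · rw [Finset.mem_filter, mem_agents] at hb
          obtain ⟨b2, b3⟩ := (harr hb.1).2 hlt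
          exact twin_succ_of hi.le hi'.le (ha.trans hb.1.symm)
            (Or.inl ⟨a2.2 ⟨h2, not_le.1 h3⟩, b2.2 ⟨h2, hb.2⟩⟩)
    · refine .of_subset hcard fun b hb => ?_
      rw [mem_agents] at hb
      obtain ⟨b2, b3⟩ := (harr hb).2 hlt
      exact twin_succ_of hi.le hi'.le (ha.trans hb.symm)
        (Or.inr ⟨s, a3 (mt a2.1 fun h => h2 h.1), b3 (mt b2.1 fun h => h2 h.1)⟩)

/-- After iteration `6n + 1` the second rounds of the iterations do not change the marks. -/
theorem marked_succ (hi : i ≤ 7 * n) (hi' : 6 * n < i) (v : ZMod n) (s : SignType) :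
    (brd g sc (2 * (i + 1)) v).Marked s ↔ (brd g sc (2 * i + 1) v).Marked s := by
  have hI : SignedInv g sc i := signedInv hi
  rw [hI.actSpec.marked]
  refine ⟨?_, Or.inl⟩
  rintro (h | ⟨a, m, hm, rfl, m', hm', rfl, hs⟩)
  · exact h
  · rw [(hI.mem_succ hm).1] at hm'
    have hr := (hI.rounds a m hm).1
    exact act_dir_marked (by omega) (hI.marked a m hm) (hI.dir_marked _) hm' hs

/-- The invariant is preserved: the groups stay on their rays, and as long as they have not met, none
of them has terminated and at least one of them moves. -/
theorem GroupInv.succ (h : GroupInv g sc u W d i p₀ p) (hd : IsDist u W d)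
    (hw : ∀ v, (brd g sc (2 * i + 1) v).waiting = true ↔ v = W) (hg : 0 < g)
    (hn : 1 < n) (hi : i < 7 * n) (hi' : 6 * n < i) :
    ∃ p', GroupInv g sc u W d (i + 1) p p' := by
  have hI : SignedInv g sc i := signedInv hi.le
  -- A group that has just reached the node of waiting agents is the first one there, or finds the
  -- mark of the other group.
  have hfirst : ∀ {a s}, s ≠ 0 → Going g sc i a s → node g sc i a = W →
      node g sc i a ≠ node g sc (i - 1) a → p₀ s < d s ∧ d s ≤ p s := by
    intro a s hs ha hnode hmv
    have h1 := h.now a s hs ha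
    rw [hnode, hd.eq s hs,
      ray_eq_ray_iff_of_le u hs (hd.pos s hs) (hd.lt hs) (h.le_n hi.le s)] at h1
    have h2 : p₀ s ≠ p s := by
      intro he
      rw [h.now a s hs ha, h.before a s hs ha, he] at hmv
      exact hmv rfl
    have := h.le s
    omega
  have hsurv : ∀ {a s}, s ≠ 0 → Going g sc (i + 1) a s →
      Going g sc i a s ∨ Going g sc i a 0 ∧ d s ≤ p s := by
    intro a s hs ha
    obtain ⟨t, ht⟩ := ha.of_succ
    by_cases ht0 : t = 0
    · subst ht0
      right
      refine ⟨ht, ?_⟩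
      obtain ⟨_, w2, w3⟩ := ht.waiting_succ hi.le hi'
      have hm : ∃ s, (brd g sc (2 * i + 1) (node g sc i a)).Marked s := by
        by_contra hc
        exact hs (ha.unique (w3 hc))
      have h1 := (w2 ha.ne_none hm).unique ha
      rw [(h.waiting a ht).1] at h1
      have h2 := hI.dir_marked W (by rwa [h1])
      rw [h1] at h2
      exact (h.marked_signed_iff hd hn hi.le hi' hs).1 h2
    · left
      rw [ha.unique ((ht.moving_succ hi.le hi' ht0).2 ha.ne_none)]
      exact ht
  have hbefore : ∀ a s, s ≠ 0 → Going g sc (i + 1) a s → node g sc i a = ray u s (p s) := by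
    intro a s hs ha
    rcases hsurv hs ha with h1 | ⟨h1, h2⟩
    · exact h.now a s hs h1
    · obtain ⟨h3, h4⟩ := h.waiting a h1
      have h5 := h4 s hs
      have h6 := h.le s
      rw [h3, hd.eq s hs, show d s = p s by omega]
  obtain ⟨p', q1, q2, q3, q4⟩ := exists_next_moves hn hi.le hi'.le hbefore
  have hW0 : (∀ s ≠ 0, p s < d s) → ∀ s ≠ 0, p₀ s < d s :=
    fun h1 s hs => (h.le s).1.trans_lt (h1 s hs)
  refine ⟨p', ⟨hbefore, q1, fun v s hs => ?_, q2, fun s => ?_, q3, ?_, fun a ha => ?_,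
    fun hf a ha hdead => ?_, fun a => ?_⟩⟩
  · rw [marked_succ hi.le hi', h.marked_signed hn hi.le hi' hs]
  · have := (q2 s).2
    have := h.bound s
    omega
  · by_cases hp : n ≤ p 1 + p (-1) + 1
    · left
      have := (q2 1).1
      have := (q2 (-1)).1
      omega
    · rcases h.progress with h1 | ⟨h1, h2⟩
      · exact absurd h1 hp
      have hgo : ∀ s, s ≠ 0 → (∃ a, Going g sc i a s) → ∃ a, Going g sc (i + 1) a s := by
        rintro s hs ⟨a, ha⟩
        obtain ⟨w1, w2⟩ := ha.moving_succ hi.le hi' hs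
        by_cases hdead : mem g sc (2 * (i + 1)) a = none
        · rcases w1.1 hdead with h3 | ⟨h3, h4⟩
          · omega
          have hps : 0 < p s := by
            by_contra h0
            have := h.le s
            refine h3 ?_
            rw [h.now a s hs ha, h.before a s hs ha, show p s = p₀ s by omega]
          have hnB := h.not_bothMarked hn hi.le hi' (by omega) hs hps
          rw [h.now a s hs ha] at h4
          have h5 := (h4.resolve_left hnB).1
          rw [hw] at h5
          rw [h5] at hnB
          have hnode : node g sc i a = W := (h.now a s hs ha).trans h5
          obtain ⟨f1, f2⟩ := hfirst hs ha hnode h3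
          have hs' : -s ≠ 0 := by simpa using hs
          have hlt : p (-s) < d (-s) := by
            by_contra hc
            refine hnB fun t ht => (h.marked_signed_iff hd hn hi.le hi' ht).2 ?_
            rcases signType_eq_or_eq_neg hs ht with rfl | rfl
            · exact f2
            · exact not_lt.1 hc
          have hW : ∀ t ≠ 0, p₀ t < d t := by
            intro t ht
            rcases signType_eq_or_eq_neg hs ht with rfl | rfl
            · exact f1
            · exact (h.le _).1.trans_lt hlt
          -- The agents of rank at most `g` go on with the joint group.
          have hcard := h.le_card_of_arrival hd hn hi.le hi' hW hs f2
          have hpos : 0 < ((agents g sc i W).filter fun b => rankAt g sc i W b ≤ g).card := by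
            rw [card_rankAt_le]
            omega
          obtain ⟨b, hb⟩ := Finset.card_pos.1 hpos
          rw [Finset.mem_filter, mem_agents] at hb
          obtain ⟨b1, b2⟩ := (h.arrival hd hw hn hi hi' hW hs f2 hb.1).2 hlt
          exact ⟨b, b2 (mt b1.1 fun h => h.2.not_ge hb.2)⟩
        · exact ⟨a, w2 hdead⟩
      have g1 := hgo 1 (by decide) h2.1
      have g2 := hgo (-1) (by decide) h2.2
      have := q4 (by omega) g1 g2
      exact Or.inr ⟨by omega, g1, g2⟩
  · obtain ⟨t, ht⟩ := ha.of_succ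
    have ht0 : t = 0 := by
      by_contra ht0
      exact ht0 (((ht.moving_succ hi.le hi' ht0).2 ha.ne_none).unique ha)
    subst ht0
    obtain ⟨h1, h2⟩ := h.waiting a ht
    obtain ⟨_, w2, _⟩ := ht.waiting_succ hi.le hi'
    rw [h1] at w2
    refine ⟨?_, fun s hs => ?_⟩
    · rw [ha.node_succ hi.le hi'.le, hop_zero, h1]
    · by_contra hc
      have hm := (h.marked_signed_iff hd hn hi.le hi' hs).2 (not_lt.1 hc)
      exact hI.waiting_dir W s ((hw W).2 rfl) hm ((w2 ha.ne_none ⟨s, hm⟩).unique ha)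
  · rw [node_succ_of_none hi.le hdead] at ha
    have hnm : ∀ t, ¬ (brd g sc (2 * i + 1) W).Marked t := fun t ht =>
      ((h.marked_signed_iff hd hn hi.le hi' ht.ne_zero).1 ht).not_gt (hf t ht.ne_zero)
    rcases none_or_going g sc i a with h0 | ⟨t, ht⟩
    · exact h.fresh (hW0 hf) a ha h0
    · by_cases ht0 : t = 0
      · subst ht0
        have := (ht.waiting_succ hi.le hi').2.2
        rw [ha] at this
        exact (this fun ⟨t, ht⟩ => hnm t ht).ne_none hdead
      · obtain ⟨m, hm, hmd, _⟩ := ht.signed hi.le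
        have := hI.marked a m hm (by rwa [hmd])
        rw [ha] at this
        exact hnm _ this
  · by_cases hW : node g sc i a = W ∧ (∀ s ≠ 0, p₀ s < d s) ∧ ∃ s ≠ 0, d s ≤ p s
    · obtain ⟨h1, h2, s, hs, h3⟩ := hW
      exact Or.inr (h.manyTwins_arrival hd hw hn hi hi' h2 hs h3 h1)
    · rcases h.twins a with h0 | h0
      · left
        obtain ⟨h1, h2⟩ := h.waiting a h0
        refine (h0.waiting_succ hi.le hi').2.2 ?_
        rw [h1, h.exists_marked_iff hd hn hi.le hi']
        exact fun h3 => hW ⟨h1, h2, h3⟩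
      · by_cases h00 : Going g sc i a 0
        · left
          obtain ⟨h1, h2⟩ := h.waiting a h00
          refine (h00.waiting_succ hi.le hi').2.2 ?_
          rw [h1, h.exists_marked_iff hd hn hi.le hi']
          exact fun h3 => hW ⟨h1, h2, h3⟩
        · right
          refine h0.mono fun b hb => hb.succ hi.le hi' h00 fun hal hwt hmv => ?_
          rw [hw] at hwt
          obtain ⟨s, ha⟩ := (none_or_going g sc i a).resolve_left hal
          have hs : s ≠ 0 := by
            rintro rfl
            exact h00 ha
          obtain ⟨f1, f2⟩ := hfirst hs ha hwt hmv
          rw [hwt]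
          refine fun t ht => (h.marked_signed_iff hd hn hi.le hi' ht).2 ?_
          rcases signType_eq_or_eq_neg hs ht with rfl | rfl
          · exact f2
          · by_contra hc
            refine hW ⟨hwt, fun r hr => ?_, s, hs, f2⟩
            rcases signType_eq_or_eq_neg hs hr with rfl | rfl
            · exact f1
            · exact (h.le _).1.trans_lt (not_le.1 hc)

end Step

end TwoGroups

/-! ### The waiting agents are reached -/

section Waiting

variable {ID : Type} [LinearOrder ID] [Fintype ID] {n k : ℕ} {g : ℕ} {sc : Scenario ID n k}
variable [NeZero n] {u W : ZMod n} {d : SignType → ℕ}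

/-- The situation after the groups have been formed at the node `u`. -/
theorem exists_groupInv_first (hg : 0 < g) (hn : 1 < n) (hd : IsDist u W d)
    (h : ∀ a, ∃ m, mem g sc (2 * (6 * n) + 1) a = some m)
    (hnode : ∀ a, node g sc (6 * n) a = W ∨ node g sc (6 * n) a = u)
    (hW : (agents g sc (6 * n) W).card < g) (hu : 2 * g ≤ (agents g sc (6 * n) u).card) :
    ∃ p, GroupInv g sc u W d (6 * n + 1) (fun _ => 0) p := by
  have hWu : W ≠ u := by
    rintro rfl
    omega
  have hwait : ∀ {a}, node g sc (6 * n) a = W → Going g sc (6 * n + 1) a 0 :=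
    fun {a} ha => (first_decision (h a) ha).1 hW
  have hmove : ∀ {a}, node g sc (6 * n) a = u → ¬ Going g sc (6 * n + 1) a 0 := by
    intro a ha h0
    obtain ⟨a3, a4, a5⟩ := (first_decision (h a) ha).2.2 hu
    rcases le_or_gt (rankAt g sc (6 * n) u a) g with h3 | h3
    · exact absurd ((a3 h3).unique h0) (by decide)
    · by_cases h4 : (agents g sc (6 * n) u).card < 3 * g ∨ rankAt g sc (6 * n) u a ≤ 2 * g
      · exact absurd ((a4 h3 h4).unique h0) (by decide)
      · exact h0.ne_none (a5 (by omega) (by omega))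
  have hu' : ∀ {a s}, s ≠ 0 → Going g sc (6 * n + 1) a s → node g sc (6 * n) a = u := by
    intro a s hs ha
    refine (hnode a).resolve_left fun h1 => hs ?_
    exact ha.unique (hwait h1)
  have hF : ∃ a, Going g sc (6 * n + 1) a 1 := by
    have hpos : 0 < ((agents g sc (6 * n) u).filter fun b => rankAt g sc (6 * n) u b ≤ g).card := by
      rw [card_rankAt_le]
      omega
    obtain ⟨a, ha⟩ := Finset.card_pos.1 hpos
    rw [Finset.mem_filter, mem_agents] at ha
    exact ⟨a, ((first_decision (h a) ha.1).2.2 hu).1 ha.2⟩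
  have hB : ∃ a, Going g sc (6 * n + 1) a (-1) := by
    have hpos : 0 < ((agents g sc (6 * n) u).filter fun b =>
        g < rankAt g sc (6 * n) u b ∧ rankAt g sc (6 * n) u b ≤ 2 * g).card := by
      rw [card_rankAt_mem_Ioc _ _ (by omega) hu]
      omega
    obtain ⟨a, ha⟩ := Finset.card_pos.1 hpos
    rw [Finset.mem_filter, mem_agents] at ha
    exact ⟨a, ((first_decision (h a) ha.1).2.2 hu).2.1 ha.2.1 (Or.inr ha.2.2)⟩
  have hexists : ∀ s, s ≠ 0 → ∃ a, Going g sc (6 * n + 1) a s := by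
    intro s hs
    rcases SignType.trichotomy s with rfl | rfl | rfl
    · exact hB
    · exact absurd rfl hs
    · exact hF
  have hbefore : ∀ a s, s ≠ 0 → Going g sc (6 * n + 1) a s →
      node g sc (6 * n) a = ray u s 0 := fun a s hs ha => by rw [hu' hs ha, ray_zero]
  obtain ⟨p, q1, q2, q3, q4⟩ := exists_next_moves (p := fun _ => 0) hn (by omega) le_rfl hbefore
  have hI : SignedInv g sc (6 * n) := signedInv (by omega)
  refine ⟨p, ⟨hbefore, q1, fun v s hs => ?_, q2, fun s => ?_, q3, Or.inr ⟨?_, hF, hB⟩,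
    fun a ha => ?_, fun _ a ha hdead => ?_, fun a => ?_⟩⟩
  · simp only [Nat.le_zero, exists_eq_left, ray_zero]
    rw [hI.actSpec.marked]
    constructor
    · rintro (h1 | ⟨a, m, hm, rfl, m', hm', hd, _⟩)
      · exact absurd h1 ((hI.early le_rfl v).2 s)
      · exact hu' hs ⟨m', hm', hd⟩
    · rintro rfl
      obtain ⟨a, ha⟩ := hexists s hs
      obtain ⟨m, hm⟩ := h a
      obtain ⟨m', hm', hd⟩ := id ha
      exact Or.inr ⟨a, m, hm, hu' hs ha, m', hm', hd, hs⟩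
  · have := (q2 s).2
    omega
  · have := q4 (by omega) hF hB
    omega
  · refine ⟨?_, fun s hs => hd.pos s hs⟩
    rw [ha.node_succ (by omega) le_rfl, hop_zero]
    exact (hnode a).resolve_right fun h1 => hmove h1 ha
  · rw [node_succ_of_none (by omega) hdead] at ha
    exact (hwait ha).ne_none hdead
  · rcases hnode a with h1 | h1
    · exact Or.inl (hwait h1)
    · refine Or.inr (manyTwins_first h ?_)
      rw [h1]
      omega

/-- If agents wait, then within `n` iterations one of the two groups that leave the other node
arrives at them. -/
theorem gathered_of_waiting (hg : 0 < g) (hn : 1 < n) (hWu : W ≠ u)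
    (h : ∀ a, ∃ m, mem g sc (2 * (6 * n) + 1) a = some m)
    (hnode : ∀ a, node g sc (6 * n) a = W ∨ node g sc (6 * n) a = u)
    (hne : ∃ a, node g sc (6 * n) a = W)
    (hW : (agents g sc (6 * n) W).card < g) (hu : 2 * g ≤ (agents g sc (6 * n) u).card) :
    Gathered g sc (7 * n + 1) := by
  obtain ⟨d, hd⟩ := exists_isDist hWu
  have hw : ∀ {i}, i ≤ 7 * n → 6 * n < i → ∀ v,
      ((brd g sc (2 * i + 1) v).waiting = true ↔ v = W) := by
    intro i hi hi' v
    rw [waiting_iff h hi hi']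
    constructor
    · rintro ⟨h1, a, rfl⟩
      refine (hnode a).resolve_right fun h2 => ?_
      rw [h2] at h1
      omega
    · rintro rfl
      exact ⟨hW, hne⟩
  have key : ∀ i, 6 * n < i → i ≤ 7 * n → ∃ p₀ p, GroupInv g sc u W d i p₀ p := by
    intro i hi'
    induction i, hi' using Nat.le_induction with
    | base => exact fun _ => ⟨_, exists_groupInv_first hg hn hd h hnode hW hu⟩
    | succ i hi' ih =>
      intro hi
      obtain ⟨p₀, p, hp⟩ := ih (by omega)
      exact ⟨p, hp.succ hd (hw (by omega) (by omega)) hg hn (by omega) (by omega)⟩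
  obtain ⟨p₀, p, hp⟩ := key (7 * n) (by omega) le_rfl
  have hlt : 6 * n < 7 * n := by omega
  have harr : ∃ s ≠ 0, d s ≤ p s := by
    have h1 := hd.add 1 (by decide)
    have h2 : n ≤ p 1 + p (-1) + 1 := by
      rcases hp.progress with h2 | ⟨h2, _⟩ <;> omega
    by_cases h3 : d 1 ≤ p 1
    · exact ⟨1, by decide, h3⟩
    · exact ⟨-1, by decide, by omega⟩
  refine gathered_of_last (fun a => ?_) fun a => ?_
  · rcases none_or_going g sc (7 * n) a with h0 | ⟨s, hs⟩
    · exact none_succ h0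
    · by_cases hs0 : s = 0
      · subst hs0
        refine (hs.waiting_succ le_rfl hlt).1.2 (Or.inr ⟨?_, Or.inl rfl⟩)
        rw [(hp.waiting a hs).1]
        exact (hp.exists_marked_iff hd hn le_rfl hlt).2 harr
      · exact (hs.moving_succ le_rfl hlt hs0).1.2 (Or.inl rfl)
  · rcases hp.twins a with h0 | h0
    · obtain ⟨h1, h2⟩ := hp.waiting a h0
      obtain ⟨s, hs, h3⟩ := harr
      rw [h1]
      exact hp.le_card_of_arrival hd hn le_rfl hlt h2 hs h3
    · exact h0.le_card

end Waiting

/-! ### Correctness of the algorithm -/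

section Main

variable {ID : Type} [LinearOrder ID] [Fintype ID] {n k : ℕ} {g : ℕ}

/-- In every execution, all agents terminate within `7n + 1` iterations as required. -/
theorem exists_gathered (sc : Scenario ID n k) (hg : 0 < g) (hk : 3 * g - 1 ≤ k) (hkn : k ≤ n) :
    ∃ i ≤ 7 * n + 1, Gathered g sc i := by
  have hn : 1 < n := by omega
  have : NeZero n := ⟨by omega⟩
  have : NeZero k := ⟨by omega⟩
  rcases gathering (g := g) (sc := sc) hn with ⟨z, hz⟩ | ⟨hall, z, hz⟩
  · refine ⟨3 * n + 1, by omega, fun a => ⟨(hz a).1, ?_⟩⟩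
    have : agents g sc (3 * n + 1) (node g sc (3 * n + 1) a) = Finset.univ := by
      ext b
      simp [(hz a).2, (hz b).2]
    rw [this, Finset.card_univ, Fintype.card_fin]
    omega
  refine ⟨7 * n + 1, le_rfl, ?_⟩
  by_cases hlarge : ∀ a, g ≤ (agents g sc (6 * n) (node g sc (6 * n) a)).card
  · exact gathered_of_no_waiting hall hlarge
  push Not at hlarge
  obtain ⟨a, ha⟩ := hlarge
  have hcompl := Finset.card_add_card_compl (agents g sc (6 * n) (node g sc (6 * n) a))
  rw [Fintype.card_fin] at hcompl
  obtain ⟨b, hb⟩ : (agents g sc (6 * n) (node g sc (6 * n) a))ᶜ.Nonempty := by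
    rw [← Finset.card_pos]
    omega
  rw [Finset.mem_compl, mem_agents] at hb
  have hnode : ∀ c, node g sc (6 * n) c = node g sc (6 * n) a ∨
      node g sc (6 * n) c = node g sc (6 * n) b := by
    intro c
    by_cases haz : node g sc (6 * n) a = z
    · by_cases hcz : node g sc (6 * n) c = z
      · exact Or.inl (hcz.trans haz.symm)
      · exact Or.inr (hz c b hcz (haz ▸ hb))
    · by_cases hcz : node g sc (6 * n) c = z
      · right
        by_contra hc
        exact hb (hz b a (fun h => hc (hcz.trans h.symm)) haz)
      · exact Or.inl (hz c a hcz haz)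
  refine gathered_of_waiting hg hn (Ne.symm hb) hall hnode ⟨a, rfl⟩ ha ?_
  have : (agents g sc (6 * n) (node g sc (6 * n) a))ᶜ ⊆
      agents g sc (6 * n) (node g sc (6 * n) b) := by
    intro c hc
    rw [Finset.mem_compl, mem_agents] at hc
    rw [mem_agents]
    exact (hnode c).resolve_left hc
  have := Finset.card_le_card this
  omega

theorem Gathered.isFinal {sc : Scenario ID n k} {i : ℕ} (h : Gathered g sc i) :
    IsFinal sc (exec (algorithm ID n k g) sc (2 * i)) := fun a => (h a).1

theorem Gathered.le_agentsAt {sc : Scenario ID n k} {i : ℕ} (h : Gathered g sc i) (a : Fin k) :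
    g ≤ agentsAt (exec (algorithm ID n k g) sc (2 * i))
      ((exec (algorithm ID n k g) sc (2 * i)).loc a) := by
  refine (h a).2.trans (Finset.card_le_card fun b hb => ?_)
  rw [mem_agents] at hb
  exact Finset.mem_filter.2 ⟨Finset.mem_univ _, hb⟩

end Main

end SmallK

end DynamicRing

theorem theorem5 :
    ∃ C : ℕ, ∀ (ID : Type) [LinearOrder ID] [Fintype ID] (g k n : ℕ),
      0 < g → 3 * g - 1 ≤ k → k ≤ 8 * g - 4 → k ≤ n →
        (DynamicRing.SmallK.algorithm ID n k g).SolvesPartialGathering n k g ∧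
        (DynamicRing.SmallK.algorithm ID n k g).TerminatesWithin n k (C * n) ∧
        (DynamicRing.SmallK.algorithm ID n k g).MovesAtMost n k (C * (k * n)) ∧
        (DynamicRing.SmallK.algorithm ID n k g).MovesAtMost n k (C * (g * n)) := by
  -- There are at most `2 * (7 * n + 1) ≤ 16 * n` rounds with at most `k ≤ 8 * g` moves each.
  refine ⟨128, fun ID _ _ g k n hg hk hk' hkn => ?_⟩
  have hmoves : ∀ (sc : DynamicRing.Scenario ID n k) t,
      DynamicRing.movesUpTo (DynamicRing.SmallK.algorithm ID n k g) sc t ≤ k * (16 * n) := by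
    intro sc t
    obtain ⟨i, hi, h⟩ := DynamicRing.SmallK.exists_gathered sc hg hk hkn
    refine (DynamicRing.SmallK.movesUpTo_le (T := 2 * i) (fun a => (h a).1) t).trans ?_
    exact Nat.mul_le_mul_left _ (by omega)
  refine ⟨fun sc => ?_, fun sc => ?_, fun sc t => ?_, fun sc t => ?_⟩
  · obtain ⟨i, hi, h⟩ := DynamicRing.SmallK.exists_gathered sc hg hk hkn
    exact ⟨2 * i, h.isFinal, h.le_agentsAt⟩
  · obtain ⟨i, hi, h⟩ := DynamicRing.SmallK.exists_gathered sc hg hk hkn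
    exact ⟨2 * i, by omega, h.isFinal⟩
  · refine (hmoves sc t).trans ?_
    nlinarith [Nat.zero_le (k * n)]
  · refine (hmoves sc t).trans ?_
    have : k * n ≤ 8 * g * n := Nat.mul_le_mul_right _ (by omega)
    nlinarith
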